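/- **Setting (infinitely many armed bandits).** An arm is a probability distribution $\nu$ on $\mathbb R$; the arm reservoir $\tilde{\mathcal L}$ is a probability distribution on the set of arms, and $\mathcal L$ is the law of the mean of an arm drawn from $\tilde{\mathcal L}$. Put $\bar\mu^\star=\inf\{m:\mathbb P_{\mu\sim\mathcal L}(\mu\le m)=1\}$. Arms $\nu_1,\nu_2,\dots$ with means $\mu_1,\mu_2,\dots$ are drawn independently from $\tilde{\mathcal L}$ and, given the arms, $X_{k,1},X_{k,2},\dots$ are independent samples of $\nu_k$, independently over $k$. Let $\beta,\tilde E,\tilde E',C>0$ and $0<\tilde B<1$. Assume 1. (bounded arms) $\tilde{\mathcal L}$-almost every arm is supported in $[-C,C]$; 2. ($\beta$-regularity) $\tilde E\varepsilon^\beta\le\mathbb P_{\mu\sim\mathcal L}(\mu>\bar\mu^\star-\varepsilon)\le\tilde E'\varepsilon^\beta$ for all $0\le\varepsilon\le\tilde B$. **SiRI** with parameters $\beta,C,\delta$, horizon $T$ and tuning constant $A>0$. Let $b=\min(\beta,2)$; let $A(T)=A$ if $\beta<2$, $A(T)=A/\log(T)^2$ if $\beta=2$, $A(T)=A/\log T$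 if $\beta>2$; let $N=\lceil A(T)T^{b/2}\rceil$ and $\bar t=\lfloor\log_2N\rfloor$. Draw $N$ arms from the reservoir, pull each once and set $t=N$. While $t\le T$: for each $k\le N$, with $n=T_k$ the current number of pulls of arm $k$, let $$B_k=\frac1n\sum_{u=1}^nX_{k,u}+2\sqrt{\frac Cn\,\ell_n}+\frac{2C}n\,\ell_n,\qquad \ell_n=\max\Big(0,\log\frac{2^{2\bar t/b}}{n\delta}\Big);$$ pull an arm $k$ that maximizes $B_k$ another $T_k$ times and increase $t$ by this number of pulls. At the end return a most pulled arm $\hat k$. Ties are broken arbitrarily. The simple regret is $r_T=\bar\mu^\star-\mu_{\hat k}$. **Theorem (upper bounds of SiRI).** Write $\operatorname{tlog}x=\max(1,\log x)$. There are constants $E>0$ and $T_0$ that depend only on $\beta,\tilde E,\tilde E',\tilde B,C$ such that for every $\delta>0$ there is a tuning constant $A>0$, depending only on $\beta,\tilde E,\tilde E',\tilde B,C,\delta$, such that for every arm reservoir $\tilde{\mathcal L}$ satisfying 1 and 2 and every integer $T\ge T_0$, with probability larger than $1-\delta$ SiRI returns an arm and, however ties are broken, - if $\beta<2$: $\; r_T\le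 E\,T^{-1/2}\,\operatorname{tlog}(1/\delta)\,\big(\operatorname{tlog}\operatorname{tlog}(1/\delta)\big)^{96}$; - if $\beta>2$: $\; r_T\le E\,(T/\log T)^{-1/\beta}\,\big(\operatorname{tlog}\operatorname{tlog}(\log(T)/\delta)\big)^{96}\,\operatorname{tlog}(\log(T)/\delta)$; - if $\beta=2$: $\; r_T\le E\,\log(T)\,T^{-1/2}\,\big(\operatorname{tlog}\operatorname{tlog}(\log(T)/\delta)\big)^{96}\,\operatorname{tlog}(\log(T)/\delta)$. In particular, for fixed $\delta$ the simple regret is $O(T^{-1/2})$ for $\beta<2$, $O(T^{-1/2}\log T\cdot\mathrm{polyloglog}\,T)$ for $\beta=2$ and $O((T/\log T)^{-1/\beta}\cdot\mathrm{polyloglog}\,T)$ for $\beta>2$. -/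

import Mathlib

open MeasureTheory ProbabilityTheory

namespace InfiniteArms

noncomputable section

/-! ### The arm reservoir -/

/-- The mean of an arm, an arm being a probability distribution on `ℝ`. -/
def armMean (ν : ProbabilityMeasure ℝ) : ℝ := ∫ x, x ∂(ν : Measure ℝ)

/-- The sequence of i.i.d. samples of an arm `ν`, as a kernel: `ν ↦ ν ⊗ ν ⊗ ν ⊗ ⋯`. -/
def sampleKernel : Kernel (ProbabilityMeasure ℝ) (ℕ → ℝ) where
  toFun ν := Measure.infinitePi (fun _ : ℕ => (ν : Measure ℝ))
  measurable' := by
    refine Measurable.measure_of_isPiSystem_of_isProbabilityMeasure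
      generateFrom_squareCylinders.symm
      (isPiSystem_squareCylinders (fun _ => MeasurableSpace.isPiSystem_measurableSet)
        (fun _ => by simp)) ?_
    rintro S ⟨s, t, ht, rfl⟩
    have ht' : ∀ i, MeasurableSet (t i) := fun i => ht i (Set.mem_univ i)
    have h : (fun ν : ProbabilityMeasure ℝ =>
        Measure.infinitePi (fun _ : ℕ => (ν : Measure ℝ)) ((s : Set ℕ).pi t))
        = fun ν : ProbabilityMeasure ℝ => ∏ i ∈ s, (ν : Measure ℝ) (t i) := by
      funext ν
      exact Measure.infinitePi_pi _ (fun i _ => ht' i)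
    rw [h]
    refine Finset.measurable_prod s (f := fun i (ν : ProbabilityMeasure ℝ) =>
      (ν : Measure ℝ) (t i)) fun i _ => ?_
    exact (Measure.measurable_coe (ht' i)).comp measurable_subtype_coe

instance : IsMarkovKernel sampleKernel :=
  ⟨fun ν => by
    change IsProbabilityMeasure (Measure.infinitePi (fun _ : ℕ => (ν : Measure ℝ)))
    infer_instance⟩

/-- The mean is a measurable function of the arm, so that the mean reservoir below is the honest
push-forward. -/
theorem measurable_armMean : Measurable armMean := by
  let κ : Kernel (ProbabilityMeasure ℝ) ℝ := ⟨fun ν => (ν : Measure ℝ), measurable_subtype_coe⟩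
  have : IsMarkovKernel κ := ⟨fun ν => (inferInstance : IsProbabilityMeasure (ν : Measure ℝ))⟩
  exact (StronglyMeasurable.integral_kernel (κ := κ) (f := fun x : ℝ => x)
    stronglyMeasurable_id).measurable

/-- The mean reservoir distribution: the law of the mean of an arm drawn from the arm reservoir
distribution `R`. -/
def meanReservoir (R : Measure (ProbabilityMeasure ℝ)) : Measure ℝ := R.map armMean

/-- The right end point `μ*` of the mean reservoir: the infimum of all `m` such that the mean of a
random arm is at most `m` with probability one. -/
def bestMean (R : Measure (ProbabilityMeasure ℝ)) : ℝ :=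
  sInf {m : ℝ | meanReservoir R (Set.Iic m) = 1}

/-- Almost every arm of the reservoir is a distribution supported in `[-C, C]`. -/
def BoundedArms (R : Measure (ProbabilityMeasure ℝ)) (C : ℝ) : Prop :=
  ∀ᵐ (ν : ProbabilityMeasure ℝ) ∂ R, (ν : Measure ℝ) (Set.Icc (-C) C) = 1

/-- `β`-regularity of the mean reservoir at its right end point, with constants `E₁` (lower),
`E₂` (upper) and range `B`. -/
def BetaRegular (R : Measure (ProbabilityMeasure ℝ)) (β E₁ E₂ B : ℝ) : Prop :=
  ∀ ε : ℝ, 0 ≤ ε → ε ≤ B →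
    E₁ * ε ^ β ≤ (meanReservoir R).real {m | bestMean R - ε < m} ∧
      (meanReservoir R).real {m | bestMean R - ε < m} ≤ E₂ * ε ^ β

/-! ### The probability space -/

/-- The law of one arm `ν` drawn from the reservoir together with its i.i.d. samples. -/
def armLaw (R : Measure (ProbabilityMeasure ℝ)) : Measure (ProbabilityMeasure ℝ × (ℕ → ℝ)) :=
  R ⊗ₘ sampleKernel

instance (R : Measure (ProbabilityMeasure ℝ)) [IsProbabilityMeasure R] :
    IsProbabilityMeasure (armLaw R) := by
  unfold armLaw; infer_instance

/-- An outcome: for the `k`-th arm drawn from the reservoir (`k = 0, 1, …`), its distribution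
`(ω k).1` and the sequence `(ω k).2` of its successive samples. -/
abbrev Outcome : Type := ℕ → ProbabilityMeasure ℝ × (ℕ → ℝ)

/-- The arms are drawn independently from the reservoir. -/
def banditLaw (R : Measure (ProbabilityMeasure ℝ)) [IsProbabilityMeasure R] : Measure Outcome :=
  Measure.infinitePi (fun _ : ℕ => armLaw R)

/-! ### The algorithm SiRI -/

/-- The factor `A(T)`. -/
def armFactor (A β : ℝ) (T : ℕ) : ℝ :=
  if β < 2 then A else if β = 2 then A / Real.log T ^ 2 else A / Real.log T

/-- The number `⌈A(T) T^(b/2)⌉`, `b = min β 2`, of arms drawn from the reservoir. -/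
def numArms (A β : ℝ) (T : ℕ) : ℕ := ⌈armFactor A β T * (T : ℝ) ^ (min β 2 / 2)⌉₊

/-- The integer part of the binary logarithm of the number of arms. -/
def logArms (A β : ℝ) (T : ℕ) : ℕ := ⌊Real.logb 2 (numArms A β T)⌋₊

/-- The empirical mean of the first `n` samples of arm `k`. -/
def empMean (ω : Outcome) (k n : ℕ) : ℝ := (∑ u ∈ Finset.range n, (ω k).2 u) / n

/-- The logarithm `log (2^(2 t / b) / (n δ))` in the confidence term, `t = logArms A β T`. Its
positive part is taken, as the square root of it has to make sense for every `n`. -/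
def confLog (A β δ : ℝ) (T n : ℕ) : ℝ :=
  Real.posLog ((2 : ℝ) ^ (2 * (logArms A β T : ℝ) / min β 2) / (n * δ))

/-- The upper confidence index of arm `k` after `n` pulls of it. -/
def index (A β C δ : ℝ) (T : ℕ) (ω : Outcome) (k n : ℕ) : ℝ :=
  empMean ω k n + 2 * √(C / n * confLog A β δ T n) + 2 * C / n * confLog A β δ T n

/-- `Reachable A β C δ T ω n`: on the outcome `ω`, a run of SiRI with horizon `T` can reach the
state in which arm `k` has been pulled `n k` times, for every arm `k`. At first every arm is pulled
once. While the number of pulls is at most `T`, some arm of maximal index is pulled as many times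
as it has been pulled before. Ties may be broken in any way. -/
inductive Reachable (A β C δ : ℝ) (T : ℕ) (ω : Outcome) : (Fin (numArms A β T) → ℕ) → Prop
  | init : Reachable A β C δ T ω (fun _ => 1)
  | pull (n : Fin (numArms A β T) → ℕ) (k : Fin (numArms A β T)) :
      Reachable A β C δ T ω n →
      ∑ j, n j ≤ T →
      (∀ j : Fin (numArms A β T), index A β C δ T ω j (n j) ≤ index A β C δ T ω k (n k)) →
      Reachable A β C δ T ω (Function.update n k (n k + n k))

/-- SiRI may return arm `k`: a run stops (more than `T` pulls have been made) in a state in which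
`k` is a most pulled arm. -/
def IsOutput (A β C δ : ℝ) (T : ℕ) (ω : Outcome) (k : Fin (numArms A β T)) : Prop :=
  ∃ n, Reachable A β C δ T ω n ∧ T < ∑ j, n j ∧ ∀ j, n j ≤ n k

/-- The event that SiRI returns an arm and that, however ties are broken, the simple regret
`μ* - μ_k` of the returned arm `k` is at most `r`. -/
def RegretAtMost (R : Measure (ProbabilityMeasure ℝ)) (A β C δ : ℝ) (T : ℕ) (r : ℝ) :
    Set Outcome :=
  {ω | (∃ k, IsOutput A β C δ T ω k) ∧
    ∀ k, IsOutput A β C δ T ω k → bestMean R - armMean (ω k).1 ≤ r}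

/-- The logarithm truncated from below at `1`. -/
def tlog (x : ℝ) : ℝ := max 1 (Real.log x)

end

end InfiniteArms

/-! Fix a target gap `s` and put the threshold at `bestMean R - s / 4`. Call an arm a champion if
its gap is below `s / 8` and its index stays above the threshold at every count `2 ^ j` with `j <
T`. If one of the `N` arms is a champion, an arm is only ever doubled while its index is above the
threshold. An arm with gap `t ≥ s` stays above the threshold only until its confidence width falls
below about `t / 4`, that is for about `(1 + log⁺(D t² / δ)) / t²` pulls, where `D = 2 ^ (2 t̄ /
b)`. So no arm with gap at least `s` exceeds `M ≍ (1 + log⁺(D s² / δ)) / s²` pulls.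

If the returned, hence most pulled, arm had gap at least `s`, then every arm, good or bad, would
have at most `M` pulls, and the total would be at most the sum of `cappedPulls`. The run stops only
after more than `T` pulls, so it suffices that this sum is below `T` (`gap_lt_of_isOutput`).

Three bad events remain, each of probability at most `δ / 4`. A single arm is a champion with
probability at least half that of a gap below `s / 8`, so of order `s ^ β`; a champion is missing
with small probability once `N s ^ β ≳ log (4 / δ)`. Overshooting `M` has exponentially small
probability for each arm, which beats the factor `N`. The capped pulls are independent and lie in
`[0, M]`, so a Chernoff bound controls their sum once its mean is at most `T / 4`. Dyadic summation
over the gap turns that mean condition into `N ∑ᵢ (2ⁱ s) ^ (β - 2) (Λ + i) ≲ T` with `Λ = 1 + log⁺(D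
s² / δ)`; this is `exists_lt_real_regretAtMost`.

The three rates come from this sum: the level `i = 0` dominates for `β < 2`, the top level for `β >
2`, and for `β = 2` all of the `O(log T)` levels count. The iterated logarithm to the power 96 is
not needed; it enters only as a factor at least one. -/

namespace InfiniteArms

/-! ### Sums along geometric sequences -/

/-- Each term is dominated by the increment of a bounded increasing function over one step of the
geometric sequence, so the sum telescopes. This makes the bound uniform in the starting point `a`
and the length `J`. -/
theorem exists_sum_rpow_mul_exp_neg_le {q γ : ℝ} (hq : 1 < q) (hγ : 0 < γ) :
    ∃ K : ℝ, 0 < K ∧ ∀ a : ℝ, 0 < a → ∀ J : ℕ,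
      ∑ j ∈ Finset.range J, (q ^ j * a) ^ γ * Real.exp (-(q ^ j * a)) ≤ K := by
  set k : ℝ := (2 * γ) ^ γ with hk
  have hk0 : 0 < k := by positivity
  set Q : ℝ := q ^ γ with hQ
  have hQ1 : 1 < Q := Real.one_lt_rpow hq hγ
  set c : ℝ := (1 + k) ^ 2 * (Q / (Q - 1)) with hc
  have hc0 : 0 < c := mul_pos (by positivity) (div_pos (by linarith) (by linarith))
  -- `F` takes values in `[0, 1]`, and its increment from `u` to `q u` is of order `u ^ γ / (1 + u ^
  -- γ) ^ 2`, which exceeds a multiple of `u ^ γ * exp (-u)`.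
  set F : ℝ → ℝ := fun u => u ^ γ / (1 + u ^ γ) with hF
  have key : ∀ u : ℝ, 0 < u → u ^ γ * Real.exp (-u) ≤ c * (F (q * u) - F u) := by
    intro u hu
    have hv : 0 < u ^ γ := by positivity
    have h1 : u ^ γ ≤ k * Real.exp (u / 2) := by
      have h2 : (u / (2 * γ)) ^ γ ≤ Real.exp (u / (2 * γ)) ^ γ :=
        Real.rpow_le_rpow (by positivity) (by linarith [Real.add_one_le_exp (u / (2 * γ))]) hγ.le
      rw [Real.div_rpow hu.le (by positivity), ← Real.exp_mul, div_le_iff₀ (by positivity)] at h2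
      have h3 : u / (2 * γ) * γ = u / 2 := by field_simp
      rw [h3] at h2; linarith
    have h4 : (1 + u ^ γ) ^ 2 ≤ (1 + k) ^ 2 * Real.exp u := by
      have h5 : 1 ≤ Real.exp (u / 2) := Real.one_le_exp (by positivity)
      have h6 : Real.exp u = Real.exp (u / 2) ^ 2 := by
        rw [← Real.exp_nat_mul]; congr 1; push_cast; ring
      rw [h6, ← mul_pow]
      gcongr
      nlinarith
    set v := u ^ γ with hv'
    have h7 : F (q * u) - F u = (Q - 1) * v / ((1 + Q * v) * (1 + v)) := by
      simp only [hF]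
      rw [Real.mul_rpow (by linarith) hu.le, ← hQ, ← hv']
      have : 0 < 1 + Q * v := by nlinarith
      field_simp
      ring
    have h8 : c * (F (q * u) - F u) = (1 + k) ^ 2 * v * (Q / ((1 + Q * v) * (1 + v))) := by
      rw [h7, hc]
      have : Q - 1 ≠ 0 := by linarith
      field_simp
    have h9 : 1 / (1 + v) ^ 2 ≤ Q / ((1 + Q * v) * (1 + v)) := by
      rw [div_le_div_iff₀ (by positivity) (by positivity)]
      nlinarith [mul_pos hv hv]
    have h10 : Real.exp (-u) ≤ (1 + k) ^ 2 * (1 / (1 + v) ^ 2) := by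
      rw [Real.exp_neg, mul_one_div, inv_eq_one_div, div_le_div_iff₀ (by positivity) (by positivity)]
      linarith
    calc v * Real.exp (-u) ≤ v * ((1 + k) ^ 2 * (1 / (1 + v) ^ 2)) := by gcongr
      _ = (1 + k) ^ 2 * v * (1 / (1 + v) ^ 2) := by ring
      _ ≤ _ := by rw [h8]; gcongr
  refine ⟨c, hc0, fun a ha J => ?_⟩
  have hF01 : ∀ u : ℝ, 0 < u → 0 ≤ F u ∧ F u ≤ 1 := by
    intro u hu
    have hv : 0 < u ^ γ := by positivity
    exact ⟨by simp only [hF]; positivity, by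
      simp only [hF]; rw [div_le_one (by positivity)]; linarith⟩
  have hpos : ∀ j : ℕ, 0 < q ^ j * a := fun j => by positivity
  calc _ ≤ ∑ j ∈ Finset.range J, c * (F (q ^ (j + 1) * a) - F (q ^ j * a)) := by
        refine Finset.sum_le_sum fun j _ => (key _ (hpos j)).trans_eq ?_
        rw [pow_succ]; congr 3; ring
    _ = c * (F (q ^ J * a) - F (q ^ 0 * a)) := by
        rw [← Finset.mul_sum, Finset.sum_range_sub (fun j => F (q ^ j * a))]
    _ ≤ c * 1 := by
        gcongr
        linarith [(hF01 _ (hpos J)).2, (hF01 _ (hpos 0)).1]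
    _ = c := mul_one c

/-! ### The width of the confidence bounds -/

/-- The width of the confidence bound after `n` pulls, for the level `D / (n δ)`. -/
noncomputable def halfWidth (C D δ : ℝ) (n : ℕ) : ℝ :=
  2 * √(C / n * Real.posLog (D / (n * δ))) + 2 * C / n * Real.posLog (D / (n * δ))

theorem halfWidth_nonneg {C : ℝ} (hC : 0 < C) (D δ : ℝ) (n : ℕ) : 0 ≤ halfWidth C D δ n := by
  have := Real.posLog_nonneg (x := D / (n * δ))
  unfold halfWidth; positivity

/-- Read by contraposition, this gives the number of pulls after which the width is at most a
quarter of the gap `t`. -/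
theorem mul_sq_le_of_lt_halfWidth {C D δ t : ℝ} {n : ℕ} (hC : 0 < C) (hD : 0 < D) (hδ : 0 < δ)
    (ht : 0 < t) (htC : t ≤ 2 * C) (hn : 0 < n) (h : t / 4 < halfWidth C D δ n) :
    n * t ^ 2 ≤ (1 + 256 * C + 32 * C ^ 2) * (1 + Real.posLog (D * t ^ 2 / δ)) := by
  have hn' : (0 : ℝ) < n := by exact_mod_cast hn
  set ℓ := Real.posLog (D / (n * δ)) with hℓ
  have hℓ0 : 0 ≤ ℓ := Real.posLog_nonneg
  set θ := C / n * ℓ with hθ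
  have hθ0 : 0 ≤ θ := by positivity
  have hw : halfWidth C D δ n = 2 * √θ + 2 * θ := by
    unfold halfWidth; rw [← hℓ, ← hθ, hθ]; ring_nf
  set K : ℝ := 1 + 256 * C + 32 * C ^ 2 with hK
  have hK1 : 1 ≤ K := by rw [hK]; nlinarith
  have h1 : n * t ^ 2 ≤ K * ℓ := by
    rcases le_or_gt (t ^ 2 / 256) θ with h2 | h2
    · have : n * (t ^ 2 / 256) ≤ n * θ := by gcongr
      have h3 : n * θ = C * ℓ := by rw [hθ]; field_simp
      rw [h3] at this
      have : n * t ^ 2 ≤ 256 * C * ℓ := by linarith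
      refine this.trans ?_
      gcongr
      rw [hK]; nlinarith
    · have h3 : √θ < t / 16 := by
        rw [Real.sqrt_lt' (by positivity)]; linarith [show (t / 16) ^ 2 = t ^ 2 / 256 by ring]
      have h4 : t / 16 < θ := by rw [hw] at h; linarith
      have h5 : t ^ 2 ≤ 32 * C * θ := by nlinarith
      have : n * t ^ 2 ≤ n * (32 * C * θ) := by gcongr
      have h3 : n * θ = C * ℓ := by rw [hθ]; field_simp
      have : n * t ^ 2 ≤ 32 * C ^ 2 * ℓ := by nlinarith
      refine this.trans ?_
      gcongr
      rw [hK]; nlinarith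
  -- The bound `K * ℓ` still depends on `n` through `ℓ`. When `n * t ^ 2 > 1`, replacing `1 / n` by
  -- `t ^ 2` inside the logarithm removes that dependence; otherwise the claim is immediate.
  rcases le_or_gt (n * t ^ 2) 1 with h2 | h2
  · have := Real.posLog_nonneg (x := D * t ^ 2 / δ)
    nlinarith
  · have h3 : ℓ ≤ Real.posLog (D * t ^ 2 / δ) := by
      refine Real.posLog_le_posLog (by positivity) ?_
      rw [div_le_div_iff₀ (by positivity) hδ]
      have : D * δ * 1 ≤ D * δ * (n * t ^ 2) := by gcongr
      linarith
    calc _ ≤ K * ℓ := h1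
      _ ≤ _ := by gcongr; linarith

/-- The squared width contributes a factor at most `(n δ / D) ^ (2 / C)` and the margin `s / 8` a
factor `exp (-n a)` with `a` of order `s ^ 2`. Written in terms of `n a`, the sum over dyadic `n` is
bounded, with a prefactor that is a negative power of `D s ^ 2 / δ`. Hence no union bound over arms
or times enters the width. -/
theorem exists_sum_exp_halfWidth_le {C : ℝ} (hC : 0 < C) :
    ∃ V : ℝ, 0 < V ∧ ∀ D δ s : ℝ, 0 < D → 0 < δ → 0 < s → V ≤ D * s ^ 2 / δ → ∀ J : ℕ,
      ∑ j ∈ Finset.range J,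
        Real.exp (-((2 ^ j : ℕ) * (halfWidth C D δ (2 ^ j) + s / 8) ^ 2 / (2 * C ^ 2))) ≤ 1 / 2 := by
  set γ : ℝ := 2 / C with hγ
  have hγ0 : 0 < γ := by positivity
  obtain ⟨K, hK, hsum⟩ := exists_sum_rpow_mul_exp_neg_le (q := 2) (γ := γ) (by norm_num) hγ0
  refine ⟨128 * C ^ 2 * (2 * K) ^ (1 / γ), by positivity, fun D δ s hD hδ hs hV J => ?_⟩
  set a : ℝ := s ^ 2 / (128 * C ^ 2) with ha
  have ha0 : 0 < a := by positivity
  set V : ℝ := D * s ^ 2 / δ with hVdef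
  have hV0 : 0 < V := by positivity
  have hterm : ∀ j : ℕ,
      Real.exp (-((2 ^ j : ℕ) * (halfWidth C D δ (2 ^ j) + s / 8) ^ 2 / (2 * C ^ 2))) ≤
        (128 * C ^ 2 / V) ^ γ * ((2 ^ j * a) ^ γ * Real.exp (-(2 ^ j * a))) := by
    intro j
    set n : ℕ := 2 ^ j with hn
    have hn0 : (0 : ℝ) < n := by simp [hn]
    have hnj : (2 : ℝ) ^ j = n := by simp [hn]
    set ℓ := Real.posLog (D / (n * δ)) with hℓ
    have hℓ0 : 0 ≤ ℓ := Real.posLog_nonneg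
    have hw1 : 2 * √(C / n * ℓ) ≤ halfWidth C D δ n := by
      unfold halfWidth; rw [← hℓ]
      have : 0 ≤ 2 * C / n * ℓ := by positivity
      linarith
    have hw2 : 4 * (C / n * ℓ) ≤ halfWidth C D δ n ^ 2 := by
      have h1 : (2 * √(C / n * ℓ)) ^ 2 ≤ halfWidth C D δ n ^ 2 := by gcongr
      rw [mul_pow, Real.sq_sqrt (by positivity)] at h1
      linarith
    have hw3 : 4 * (C / n * ℓ) + s ^ 2 / 64 ≤ (halfWidth C D δ n + s / 8) ^ 2 := by
      nlinarith [halfWidth_nonneg hC D δ n]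
    have hexp : γ * ℓ + n * a ≤ n * (halfWidth C D δ n + s / 8) ^ 2 / (2 * C ^ 2) := by
      have h1 : γ * ℓ + n * a = n * (4 * (C / n * ℓ) + s ^ 2 / 64) / (2 * C ^ 2) := by
        rw [hγ, ha]; field_simp; ring
      rw [h1]; gcongr
    have hlog : Real.exp (-(γ * ℓ)) ≤ (128 * C ^ 2 / V) ^ γ * (n * a) ^ γ := by
      rw [← Real.mul_rpow (by positivity) (by positivity)]
      have h1 : 128 * C ^ 2 / V * (n * a) = (D / (n * δ))⁻¹ := by
        rw [ha, hVdef]; field_simp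
      rw [h1, Real.inv_rpow (by positivity), Real.rpow_def_of_pos (by positivity), ← Real.exp_neg]
      have h2 : Real.log (D / (n * δ)) ≤ ℓ := le_max_right _ _
      exact Real.exp_le_exp.2 (by nlinarith)
    rw [hnj]
    calc _ ≤ Real.exp (-(γ * ℓ) + -(n * a)) := by gcongr; linarith
      _ = Real.exp (-(γ * ℓ)) * Real.exp (-(n * a)) := Real.exp_add _ _
      _ ≤ ((128 * C ^ 2 / V) ^ γ * (n * a) ^ γ) * Real.exp (-(n * a)) := by gcongr
      _ = _ := by ring
  calc _ ≤ ∑ j ∈ Finset.range J,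
        (128 * C ^ 2 / V) ^ γ * ((2 ^ j * a) ^ γ * Real.exp (-(2 ^ j * a))) :=
        Finset.sum_le_sum fun j _ => hterm j
    _ ≤ (128 * C ^ 2 / V) ^ γ * K := by rw [← Finset.mul_sum]; gcongr; exact hsum a ha0 J
    _ ≤ (((2 * K) ^ (1 / γ))⁻¹) ^ γ * K := by
        gcongr
        rw [div_le_iff₀ hV0, inv_mul_eq_div, le_div_iff₀ (by positivity)]
        exact hV
    _ = 1 / 2 := by
        rw [Real.inv_rpow (by positivity), ← Real.rpow_mul (by positivity)]
        have : 1 / γ * γ = 1 := by field_simp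
        rw [this, Real.rpow_one]; field_simp

theorem sum_two_pow_ite_le {x : ℝ} (hx : 0 ≤ x) (J : ℕ) :
    ∑ j ∈ Finset.range J, (if (2 : ℝ) ^ j ≤ x then (2 : ℝ) ^ j else 0) ≤ 2 * x := by
  induction J with
  | zero => simpa using hx
  | succ J ih =>
    rw [Finset.sum_range_succ]
    split_ifs with h
    · have h1 : ∑ j ∈ Finset.range J, (if (2 : ℝ) ^ j ≤ x then (2 : ℝ) ^ j else 0)
          ≤ ∑ j ∈ Finset.range J, (2 : ℝ) ^ j := by
        refine Finset.sum_le_sum fun j _ => ?_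
        split_ifs <;> first | exact le_rfl | positivity
      rw [geom_sum_eq (by norm_num)] at h1
      have : (2 : ℝ) - 1 = 1 := by norm_num
      rw [this, div_one] at h1
      linarith
    · linarith

/-- The sum bounds the expected number of pulls of an arm with gap `t`, `p j` being the chance that
its index is still above the threshold after `2 ^ j` pulls. Counts too small for the width to be
below `t / 4` form a geometric sum; the others have exponential tails. -/
theorem exists_sum_two_pow_mul_le {C : ℝ} (hC : 0 < C) :
    ∃ K : ℝ, 0 < K ∧ ∀ (D δ t : ℝ) (p : ℕ → ℝ), 0 < D → 0 < δ → 0 < t → t ≤ 2 * C →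
      (∀ j, p j ≤ 1) →
      (∀ j, halfWidth C D δ (2 ^ j) ≤ t / 4 →
        p j ≤ Real.exp (-((2 ^ j : ℕ) * t ^ 2 / (8 * C ^ 2)))) → ∀ J : ℕ,
      1 + ∑ j ∈ Finset.range J, 2 ^ j * p j ≤ K * (1 + Real.posLog (D * t ^ 2 / δ)) / t ^ 2 := by
  obtain ⟨K, hK, hsum⟩ := exists_sum_rpow_mul_exp_neg_le (q := 2) (γ := 1) (by norm_num) one_pos
  set K' : ℝ := 1 + 256 * C + 32 * C ^ 2 with hK'
  have hK'0 : 0 < K' := by positivity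
  refine ⟨4 * C ^ 2 + 2 * K' + 8 * C ^ 2 * K, by positivity,
    fun D δ t p hD hδ ht htC hp1 hp J => ?_⟩
  set Λ := 1 + Real.posLog (D * t ^ 2 / δ) with hΛ
  have hΛ1 : 1 ≤ Λ := by rw [hΛ]; linarith [Real.posLog_nonneg (x := D * t ^ 2 / δ)]
  set x : ℝ := K' * Λ / t ^ 2 with hx
  set a : ℝ := t ^ 2 / (8 * C ^ 2) with ha
  have ha0 : 0 < a := by positivity
  have hterm : ∀ j : ℕ, (2 : ℝ) ^ j * p j ≤ (if (2 : ℝ) ^ j ≤ x then (2 : ℝ) ^ j else 0)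
      + (2 ^ j * a) ^ (1 : ℝ) * Real.exp (-(2 ^ j * a)) / a := by
    intro j
    have h0 : 0 ≤ (2 ^ j * a) ^ (1 : ℝ) * Real.exp (-(2 ^ j * a)) / a := by positivity
    split_ifs with h
    · have : (2 : ℝ) ^ j * p j ≤ 2 ^ j * 1 := by gcongr; exact hp1 j
      linarith
    · have h1 : halfWidth C D δ (2 ^ j) ≤ t / 4 := by
        by_contra! h2
        have h3 := mul_sq_le_of_lt_halfWidth hC hD hδ ht htC (by positivity) h2
        apply h
        rw [hx, le_div_iff₀ (by positivity)]
        exact_mod_cast h3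
      have h2 := hp j h1
      rw [Real.rpow_one, zero_add]
      calc (2 : ℝ) ^ j * p j ≤ 2 ^ j * Real.exp (-(2 ^ j * a)) := by
            gcongr
            refine h2.trans_eq ?_
            rw [ha]; push_cast; congr 1; ring
        _ = _ := by field_simp
  have hsum1 : ∑ j ∈ Finset.range J, (2 : ℝ) ^ j * p j ≤ 2 * x + K / a := by
    refine (Finset.sum_le_sum fun j _ => hterm j).trans ?_
    rw [Finset.sum_add_distrib, ← Finset.sum_div]
    gcongr
    · exact sum_two_pow_ite_le (by positivity) J
    · exact hsum a ha0 J
  have h1 : 1 ≤ 4 * C ^ 2 * Λ / t ^ 2 := by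
    rw [le_div_iff₀ (by positivity)]
    nlinarith
  have h2 : K / a ≤ 8 * C ^ 2 * K * Λ / t ^ 2 := by
    rw [ha, div_div_eq_mul_div]
    refine div_le_div_of_nonneg_right ?_ (by positivity)
    nlinarith [show 0 < C ^ 2 * K by positivity]
  calc _ ≤ 4 * C ^ 2 * Λ / t ^ 2 + (2 * x + 8 * C ^ 2 * K * Λ / t ^ 2) := by linarith
    _ = _ := by rw [hx]; ring

/-- `M` is at least twice the count at which the width drops to `t / 4`, so all surviving `j` are in
the exponential regime. One half of the exponent gives the stated factor, the other half makes the
sum converge. -/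
theorem exists_sum_tail_le {C : ℝ} (hC : 0 < C) :
    ∃ K : ℝ, 0 < K ∧ ∀ (D δ t M : ℝ) (p : ℕ → ℝ), 0 < D → 0 < δ → 0 < t → t ≤ 2 * C →
      2 * (1 + 256 * C + 32 * C ^ 2) * (1 + Real.posLog (D * t ^ 2 / δ)) ≤ M * t ^ 2 →
      (∀ j, halfWidth C D δ (2 ^ j) ≤ t / 4 →
        p j ≤ Real.exp (-((2 ^ j : ℕ) * t ^ 2 / (8 * C ^ 2)))) → ∀ J : ℕ,
      ∑ j ∈ Finset.range J, (if M < 2 ^ (j + 1) then p j else 0)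
        ≤ K * Real.exp (-(M * t ^ 2 / (32 * C ^ 2))) := by
  obtain ⟨K, hK, hsum⟩ := exists_sum_rpow_mul_exp_neg_le (q := 2) (γ := 1) (by norm_num) one_pos
  refine ⟨K, hK, fun D δ t M p hD hδ ht htC hM hp J => ?_⟩
  set Λ := 1 + Real.posLog (D * t ^ 2 / δ) with hΛ
  have hΛ1 : 1 ≤ Λ := by rw [hΛ]; linarith [Real.posLog_nonneg (x := D * t ^ 2 / δ)]
  set a : ℝ := t ^ 2 / (16 * C ^ 2) with ha
  have ha0 : 0 < a := by positivity
  have hMa : M * t ^ 2 / (32 * C ^ 2) = M / 2 * a := by rw [ha]; field_simp; ring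
  have hMa1 : 1 ≤ M / 2 * a := by
    rw [← hMa, le_div_iff₀ (by positivity)]
    nlinarith [mul_le_mul_of_nonneg_left hΛ1 (show 0 ≤ 2 * (1 + 256 * C + 32 * C ^ 2) by positivity)]
  rw [hMa]
  have hterm : ∀ j : ℕ, (if M < 2 ^ (j + 1) then p j else 0) ≤
      Real.exp (-(M / 2 * a)) * ((2 ^ j * a) ^ (1 : ℝ) * Real.exp (-(2 ^ j * a))) := by
    intro j
    split_ifs with h
    · have hj : M / 2 < 2 ^ j := by rw [pow_succ] at h; linarith
      have hja : M / 2 * a ≤ 2 ^ j * a := by gcongr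
      have h1 : halfWidth C D δ (2 ^ j) ≤ t / 4 := by
        by_contra! h2
        have h3 := mul_sq_le_of_lt_halfWidth hC hD hδ ht htC (by positivity) h2
        push_cast at h3
        have h4 : M / 2 * t ^ 2 < 2 ^ j * t ^ 2 := by gcongr
        linarith
      refine (hp j h1).trans ?_
      rw [Real.rpow_one]
      calc Real.exp (-((2 ^ j : ℕ) * t ^ 2 / (8 * C ^ 2)))
          = Real.exp (-(2 ^ j * a)) * (1 * Real.exp (-(2 ^ j * a))) := by
            rw [one_mul, ← Real.exp_add, ha]; push_cast; congr 1; field_simp; norm_num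
        _ ≤ _ := by
            gcongr
            linarith
    · positivity
  calc _ ≤ ∑ j ∈ Finset.range J,
        Real.exp (-(M / 2 * a)) * ((2 ^ j * a) ^ (1 : ℝ) * Real.exp (-(2 ^ j * a))) :=
        Finset.sum_le_sum fun j _ => hterm j
    _ ≤ Real.exp (-(M / 2 * a)) * K := by rw [← Finset.mul_sum]; gcongr; exact hsum a ha0 J
    _ = _ := mul_comm _ _

/-! ### Concentration of the empirical means of one arm -/

section Hoeffding

variable {ν : ProbabilityMeasure ℝ} {C : ℝ}

theorem ae_mem_Icc_of_supported (hν : (ν : Measure ℝ) (Set.Icc (-C) C) = 1) :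
    ∀ᵐ x ∂(ν : Measure ℝ), x ∈ Set.Icc (-C) C :=
  (mem_ae_iff_prob_eq_one measurableSet_Icc).2 hν

theorem armMean_mem_Icc (hν : (ν : Measure ℝ) (Set.Icc (-C) C) = 1) :
    armMean ν ∈ Set.Icc (-C) C := by
  have h := ae_mem_Icc_of_supported hν
  have hint : Integrable (fun x : ℝ => x) (ν : Measure ℝ) :=
    Integrable.of_mem_Icc (-C) C aemeasurable_id h
  constructor
  · have := integral_mono_ae (integrable_const (-C)) hint (h.mono fun x hx => hx.1)
    simpa [armMean] using this
  · have := integral_mono_ae hint (integrable_const C) (h.mono fun x hx => hx.2)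
    simpa [armMean] using this

theorem sampleKernel_apply (ν : ProbabilityMeasure ℝ) :
    sampleKernel ν = Measure.infinitePi (fun _ : ℕ => (ν : Measure ℝ)) := rfl

theorem sampleKernel_real_sum_ge_le (hC : 0 < C) (hν : (ν : Measure ℝ) (Set.Icc (-C) C) = 1)
    {f : ℝ → ℝ} (hf : Measurable f) (hfC : ∀ x ∈ Set.Icc (-C) C, f x ∈ Set.Icc (-C) C)
    {n : ℕ} (hn : 0 < n) {x : ℝ} (hx : 0 ≤ x) :
    (sampleKernel ν).real {y | n * x ≤ ∑ u ∈ Finset.range n, (f (y u) - ∫ z, f z ∂(ν : Measure ℝ))}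
      ≤ Real.exp (-(n * x ^ 2 / (2 * C ^ 2))) := by
  rw [sampleKernel_apply]
  set c : NNReal := (‖C - -C‖₊ / 2) ^ 2 with hc
  have hcC : (c : ℝ) = C ^ 2 := by
    rw [hc]; push_cast
    rw [show C - -C = 2 * C by ring, Real.norm_of_nonneg (by positivity)]; ring
  have hsub : HasSubgaussianMGF (fun z => f z - ∫ z, f z ∂(ν : Measure ℝ)) c (ν : Measure ℝ) :=
    hasSubgaussianMGF_of_mem_Icc hf.aemeasurable
      ((ae_mem_Icc_of_supported hν).mono fun z hz => hfC z hz)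
  have hind : iIndepFun (fun (u : ℕ) (y : ℕ → ℝ) => f (y u) - ∫ z, f z ∂(ν : Measure ℝ))
      (Measure.infinitePi (fun _ : ℕ => (ν : Measure ℝ))) :=
    iIndepFun_infinitePi (X := fun (_ : ℕ) z => f z - ∫ z, f z ∂(ν : Measure ℝ))
      (fun _ => by fun_prop)
  have hsub' : ∀ u < n, HasSubgaussianMGF
      (fun y : ℕ → ℝ => f (y u) - ∫ z, f z ∂(ν : Measure ℝ)) c
      (Measure.infinitePi (fun _ : ℕ => (ν : Measure ℝ))) := by
    intro u _
    have hmap : (Measure.infinitePi (fun _ : ℕ => (ν : Measure ℝ))).map (fun y => y u) = ν :=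
      Measure.infinitePi_map_eval _ u
    have hsub2 : HasSubgaussianMGF (fun z => f z - ∫ z, f z ∂(ν : Measure ℝ)) c
        ((Measure.infinitePi (fun _ : ℕ => (ν : Measure ℝ))).map (fun y => y u)) := by
      rw [hmap]; exact hsub
    exact hsub2.of_map (Y := fun y : ℕ → ℝ => y u) (measurable_pi_apply u).aemeasurable
  refine (HasSubgaussianMGF.measure_sum_range_ge_le_of_iIndepFun hind hsub'
    (by positivity)).trans_eq ?_
  have : (n : ℝ) ≠ 0 := by positivity
  rw [hcC]; congr 1; field_simp

theorem sampleKernel_real_mean_ge_le (hC : 0 < C) (hν : (ν : Measure ℝ) (Set.Icc (-C) C) = 1)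
    {n : ℕ} (hn : 0 < n) {x : ℝ} (hx : 0 ≤ x) :
    (sampleKernel ν).real {y | armMean ν + x ≤ (∑ u ∈ Finset.range n, y u) / n}
      ≤ Real.exp (-(n * x ^ 2 / (2 * C ^ 2))) := by
  refine le_trans (le_of_eq ?_)
    (sampleKernel_real_sum_ge_le hC hν measurable_id (fun x hx => hx) hn hx)
  congr 1; ext y
  have hn' : (0 : ℝ) < n := by exact_mod_cast hn
  simp only [Set.mem_ofPred_eq, id, Finset.sum_sub_distrib, Finset.sum_const, Finset.card_range,
    nsmul_eq_mul, armMean]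
  rw [le_div_iff₀ hn', add_mul, mul_comm x, mul_comm (∫ x, x ∂(ν : Measure ℝ))]
  constructor <;> intro h <;> linarith

theorem sampleKernel_real_mean_le_le (hC : 0 < C) (hν : (ν : Measure ℝ) (Set.Icc (-C) C) = 1)
    {n : ℕ} (hn : 0 < n) {x : ℝ} (hx : 0 ≤ x) :
    (sampleKernel ν).real {y | (∑ u ∈ Finset.range n, y u) / n ≤ armMean ν - x}
      ≤ Real.exp (-(n * x ^ 2 / (2 * C ^ 2))) := by
  refine le_trans (le_of_eq ?_)
    (sampleKernel_real_sum_ge_le hC hν measurable_neg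
      (fun x hx => ⟨neg_le_neg hx.2, by linarith [hx.1]⟩) hn hx)
  congr 1; ext y
  have hn' : (0 : ℝ) < n := by exact_mod_cast hn
  simp only [Set.mem_ofPred_eq, Finset.sum_sub_distrib, Finset.sum_const, Finset.card_range,
    nsmul_eq_mul, armMean, Finset.sum_neg_distrib]
  rw [integral_neg]
  rw [div_le_iff₀ hn', sub_mul, mul_comm x, mul_comm (∫ x, x ∂(ν : Measure ℝ))]
  constructor <;> intro h <;> linarith

end Hoeffding

/-! ### The gaps of the arms of the reservoir -/

/-- The gap of an arm: the difference between the best mean of the reservoir and its mean. -/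
noncomputable def gap (R : Measure (ProbabilityMeasure ℝ)) (ν : ProbabilityMeasure ℝ) : ℝ :=
  bestMean R - armMean ν

theorem measurable_gap (R : Measure (ProbabilityMeasure ℝ)) : Measurable (gap R) :=
  measurable_const.sub measurable_armMean

section Reservoir

variable {R : Measure (ProbabilityMeasure ℝ)} [IsProbabilityMeasure R] {C : ℝ}

theorem bestMean_mem_Icc (hR : BoundedArms R C) : bestMean R ∈ Set.Icc (-C) C := by
  have hae : ∀ᵐ ν ∂ R, armMean ν ∈ Set.Icc (-C) C := hR.mono fun ν hν => armMean_mem_Icc hν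
  have hmem : C ∈ {m : ℝ | meanReservoir R (Set.Iic m) = 1} := by
    simp only [Set.mem_ofPred_eq, meanReservoir]
    rw [Measure.map_apply measurable_armMean measurableSet_Iic,
      ← mem_ae_iff_prob_eq_one (measurable_armMean measurableSet_Iic)]
    exact hae.mono fun ν hν => hν.2
  have hlb : ∀ m ∈ {m : ℝ | meanReservoir R (Set.Iic m) = 1}, -C ≤ m := by
    intro m hm
    simp only [Set.mem_ofPred_eq, meanReservoir] at hm
    rw [Measure.map_apply measurable_armMean measurableSet_Iic,
      ← mem_ae_iff_prob_eq_one (measurable_armMean measurableSet_Iic)] at hm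
    have h2 : ∀ᵐ ν ∂ R, armMean ν ≤ m := hm
    obtain ⟨ν, h3, h4⟩ := (hae.and h2).exists
    exact h3.1.trans h4
  exact ⟨le_csInf ⟨C, hmem⟩ hlb, csInf_le ⟨-C, hlb⟩ hmem⟩

theorem ae_gap_le (hR : BoundedArms R C) : ∀ᵐ ν ∂ R, gap R ν ≤ 2 * C := by
  have h1 := bestMean_mem_Icc hR
  filter_upwards [hR] with ν hν
  have h2 := armMean_mem_Icc hν
  unfold gap; linarith [h1.2, h2.1]

theorem measureReal_gap_lt (R : Measure (ProbabilityMeasure ℝ)) (ε : ℝ) :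
    R.real {ν | gap R ν < ε} = (meanReservoir R).real {m | bestMean R - ε < m} := by
  unfold meanReservoir
  have hset : {m | bestMean R - ε < m} = Set.Ioi (bestMean R - ε) := by ext; simp
  rw [hset, map_measureReal_apply measurable_armMean measurableSet_Ioi]
  congr 1; ext ν
  simp only [gap, Set.mem_ofPred_eq, Set.mem_preimage, Set.mem_Ioi]
  constructor <;> intro h <;> linarith

theorem measureReal_gap_lt_le {β E₁ E₂ B : ℝ} (hβ : 0 < β) (hE₂ : 0 < E₂) (hB : 0 < B)
    (hR : BetaRegular R β E₁ E₂ B) {ε : ℝ} (hε : 0 ≤ ε) :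
    R.real {ν | gap R ν < ε} ≤ (E₂ + B ^ (-β)) * ε ^ β := by
  rcases le_or_gt ε B with h | h
  -- The summand `B ^ (-β)` of the constant serves `ε > B`, where a probability is at most `1 ≤ (ε /
  -- B) ^ β`.
  · rw [measureReal_gap_lt]
    refine (hR ε hε h).2.trans ?_
    gcongr
    have : 0 < B ^ (-β) := by positivity
    linarith
  · refine measureReal_le_one.trans ?_
    have h1 : 1 ≤ B ^ (-β) * ε ^ β := by
      rw [Real.rpow_neg hB.le, inv_mul_eq_div, one_le_div (by positivity)]
      gcongr
    have : 0 ≤ E₂ * ε ^ β := by positivity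
    linarith

/-- Integration over the arms with gap at least `s`, along dyadic levels of the gap. -/
theorem setLIntegral_gap_le {β E₁ E₂ B : ℝ} (hβ : 0 < β) (hE₂ : 0 < E₂) (hB : 0 < B)
    (hbd : BoundedArms R C) (hR : BetaRegular R β E₁ E₂ B) {s : ℝ} (hs : 0 < s) {I : ℕ}
    (hI : 2 * C < 2 ^ (I + 1) * s) {h : ProbabilityMeasure ℝ → ENNReal} {c : ℕ → ℝ}
    (hc : ∀ i, 0 ≤ c i)
    (hh : ∀ᵐ ν ∂ R, ∀ i, 2 ^ i * s ≤ gap R ν → h ν ≤ ENNReal.ofReal (c i)) :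
    ∫⁻ ν in {ν | s ≤ gap R ν}, h ν ∂ R ≤ ENNReal.ofReal
      (∑ i ∈ Finset.range (I + 1), c i * ((E₂ + B ^ (-β)) * (2 ^ (i + 1) * s) ^ β)) := by
  have hm : MeasurableSet {ν | s ≤ gap R ν} := measurable_gap R measurableSet_Ici
  have hm' : ∀ ε : ℝ, MeasurableSet {ν | gap R ν < ε} := fun ε => measurable_gap R measurableSet_Iio
  rw [← lintegral_indicator hm]
  calc _ ≤ ∫⁻ ν, ∑ i ∈ Finset.range (I + 1),
        {ν | gap R ν < 2 ^ (i + 1) * s}.indicator (fun _ => ENNReal.ofReal (c i)) ν ∂ R := by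
        refine lintegral_mono_ae ?_
        filter_upwards [hh, ae_gap_le hbd] with ν hν hν2
        by_cases hsν : ν ∈ {ν | s ≤ gap R ν}
        swap
        · rw [Set.indicator_of_notMem hsν]; exact zero_le
        rw [Set.indicator_of_mem hsν]
        have hex : ∃ i : ℕ, gap R ν < 2 ^ (i + 1) * s := ⟨I, hν2.trans_lt hI⟩
        classical
        -- The least such `i` is the dyadic level of the arm: minimality gives `2 ^ i * s ≤ gap R
        -- ν`.
        obtain ⟨i, hi, hmin⟩ : ∃ i : ℕ, gap R ν < 2 ^ (i + 1) * s ∧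
            ∀ i' < i, ¬ gap R ν < 2 ^ (i' + 1) * s :=
          ⟨Nat.find hex, Nat.find_spec hex, fun i' hi' => Nat.find_min hex hi'⟩
        have hiI : i < I + 1 := by
          by_contra! hlt
          exact hmin I (by omega) (hν2.trans_lt hI)
        have hlow : 2 ^ i * s ≤ gap R ν := by
          rcases i with _ | i
          · simpa using hsν
          · exact not_lt.1 (hmin i (by omega))
        have h1 := Finset.single_le_sum (s := Finset.range (I + 1))
          (f := fun i : ℕ => {ν | gap R ν < 2 ^ (i + 1) * s}.indicator
            (fun _ => ENNReal.ofReal (c i)) ν) (fun _ _ => zero_le) (Finset.mem_range.2 hiI)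
        refine (hν i hlow).trans (le_trans ?_ h1)
        have hmem : ν ∈ {ν | gap R ν < 2 ^ (i + 1) * s} := hi
        simp only [Set.indicator_of_mem hmem, le_refl]
    _ = ∑ i ∈ Finset.range (I + 1), ENNReal.ofReal (c i) * R {ν | gap R ν < 2 ^ (i + 1) * s} := by
        rw [lintegral_finsetSum _ fun i _ => measurable_const.indicator (hm' _)]
        simp_rw [lintegral_indicator_const (hm' _)]
    _ ≤ _ := by
        rw [ENNReal.ofReal_sum_of_nonneg fun i _ => mul_nonneg (hc i) (by positivity)]
        refine Finset.sum_le_sum fun i _ => ?_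
        rw [ENNReal.ofReal_mul (hc i)]
        gcongr
        rw [← ofReal_measureReal]
        exact ENNReal.ofReal_le_ofReal (measureReal_gap_lt_le hβ hE₂ hB hR (by positivity))

end Reservoir

/-! ### One arm of the reservoir with its samples -/

section OneArm

/-- The upper confidence index of an arm with samples `y` after `n` pulls, for the width `w`. -/
noncomputable def armIndex (w : ℕ → ℝ) (y : ℕ → ℝ) (n : ℕ) : ℝ :=
  (∑ u ∈ Finset.range n, y u) / n + w n

theorem measurable_armIndex (w : ℕ → ℝ) (n : ℕ) : Measurable fun y => armIndex w y n := by
  unfold armIndex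
  fun_prop

theorem measurableSet_le_armIndex (w : ℕ → ℝ) (m : ℝ) (n : ℕ) :
    MeasurableSet {y | m ≤ armIndex w y n} :=
  measurableSet_le measurable_const (measurable_armIndex w n)

/-- The arms with gap less than `s / 8` whose index never drops below `bestMean R - s / 4`. -/
def championSet (R : Measure (ProbabilityMeasure ℝ)) (w : ℕ → ℝ) (s : ℝ) (J : ℕ) :
    Set (ProbabilityMeasure ℝ × (ℕ → ℝ)) :=
  {a | gap R a.1 < s / 8 ∧ ∀ j < J, bestMean R - s / 4 ≤ armIndex w a.2 (2 ^ j)}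

/-- The arms with gap at least `s` whose index exceeds `bestMean R - s / 4` after more than
`M / 2` pulls. -/
def overshootSet (R : Measure (ProbabilityMeasure ℝ)) (w : ℕ → ℝ) (s M : ℝ) (J : ℕ) :
    Set (ProbabilityMeasure ℝ × (ℕ → ℝ)) :=
  {a | s ≤ gap R a.1 ∧
    ∃ j < J, M < 2 ^ (j + 1) ∧ bestMean R - s / 4 ≤ armIndex w a.2 (2 ^ j)}

/-- A bound for the number of pulls of an arm as long as the maximal index is at least `m`. -/
noncomputable def pullBound (w : ℕ → ℝ) (m : ℝ) (J : ℕ) (y : ℕ → ℝ) : ℝ :=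
  1 + ∑ j ∈ Finset.range J, {y | m ≤ armIndex w y (2 ^ j)}.indicator (fun _ => (2 : ℝ) ^ j) y

/-- The number of pulls of an arm, bounded by `M`, and replaced by `M` if the gap is less than
`s`. -/
noncomputable def cappedPulls (R : Measure (ProbabilityMeasure ℝ)) (w : ℕ → ℝ) (s M : ℝ) (J : ℕ)
    (a : ProbabilityMeasure ℝ × (ℕ → ℝ)) : ℝ :=
  if gap R a.1 < s then M else min (pullBound w (bestMean R - s / 4) J a.2) M

theorem measurable_pullBound (w : ℕ → ℝ) (m : ℝ) (J : ℕ) : Measurable (pullBound w m J) := by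
  unfold pullBound
  exact measurable_const.add (Finset.measurable_sum _ fun j _ =>
    measurable_const.indicator (measurableSet_le_armIndex w m _))

theorem pullBound_nonneg (w : ℕ → ℝ) (m : ℝ) (J : ℕ) (y : ℕ → ℝ) : 0 ≤ pullBound w m J y :=
  add_nonneg zero_le_one
    (Finset.sum_nonneg fun j _ => Set.indicator_nonneg (fun _ _ => by positivity) y)

variable {R : Measure (ProbabilityMeasure ℝ)}

theorem measurableSet_gap_fst_lt (s : ℝ) :
    MeasurableSet {a : ProbabilityMeasure ℝ × (ℕ → ℝ) | gap R a.1 < s} :=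
  measurableSet_lt ((measurable_gap R).comp measurable_fst) measurable_const

theorem measurable_cappedPulls (w : ℕ → ℝ) (s M : ℝ) (J : ℕ) :
    Measurable (cappedPulls R w s M J) := by
  unfold cappedPulls
  exact Measurable.ite (measurableSet_gap_fst_lt s) measurable_const
    (((measurable_pullBound w _ J).comp measurable_snd).min measurable_const)

theorem measurableSet_championSet (w : ℕ → ℝ) (s : ℝ) (J : ℕ) :
    MeasurableSet (championSet R w s J) := by
  have h : championSet R w s J = {a | gap R a.1 < s / 8} ∩
      ⋂ j, ⋂ (_ : j < J), Prod.snd ⁻¹' {y | bestMean R - s / 4 ≤ armIndex w y (2 ^ j)} := by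
    ext a; simp [championSet]
  rw [h]
  exact (measurableSet_gap_fst_lt _).inter (MeasurableSet.iInter fun j => MeasurableSet.iInter
    fun _ => measurable_snd (measurableSet_le_armIndex w _ _))

theorem measurableSet_overshootSet (w : ℕ → ℝ) (s M : ℝ) (J : ℕ) :
    MeasurableSet (overshootSet R w s M J) := by
  have h : overshootSet R w s M J = {a | gap R a.1 < s}ᶜ ∩
      ⋃ j, ⋃ (_ : j < J ∧ M < 2 ^ (j + 1)),
        Prod.snd ⁻¹' {y | bestMean R - s / 4 ≤ armIndex w y (2 ^ j)} := by
    ext a; simp [overshootSet, and_assoc]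
  rw [h]
  exact (measurableSet_gap_fst_lt _).compl.inter (MeasurableSet.iUnion fun j =>
    MeasurableSet.iUnion fun _ => measurable_snd (measurableSet_le_armIndex w _ _))

/-- The empirical mean must exceed its expectation by at least `t - s / 4 - t / 4 ≥ t / 2`, and
Hoeffding's inequality applies. -/
theorem sampleKernel_real_le_armIndex {C : ℝ} (hC : 0 < C) {ν : ProbabilityMeasure ℝ}
    (hν : (ν : Measure ℝ) (Set.Icc (-C) C) = 1) {w : ℕ → ℝ} {s t : ℝ} (hs : 0 < s) (hst : s ≤ t)
    (htν : t ≤ gap R ν) {n : ℕ} (hn : 0 < n) (hw : w n ≤ t / 4) :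
    (sampleKernel ν).real {y | bestMean R - s / 4 ≤ armIndex w y n}
      ≤ Real.exp (-(n * t ^ 2 / (8 * C ^ 2))) := by
  have h1 := sampleKernel_real_mean_ge_le hC hν hn (x := t / 2) (by linarith)
  have h2 : (n : ℝ) * (t / 2) ^ 2 / (2 * C ^ 2) = n * t ^ 2 / (8 * C ^ 2) := by
    field_simp; norm_num
  rw [h2] at h1
  refine (measureReal_mono ?_).trans h1
  intro y hy
  simp only [Set.mem_ofPred_eq, armIndex, gap] at hy htν ⊢
  linarith

variable [IsProbabilityMeasure R] {C : ℝ}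

/-- For gap below `s / 8` the mean lies at least `s / 8` above the threshold, so a failure at count
`2 ^ j` is a downward deviation by `w (2 ^ j) + s / 8`. Success with conditional probability one
half is enough, since many arms are drawn. -/
theorem armLaw_championSet_ge (hC : 0 < C) (hbd : BoundedArms R C) {w : ℕ → ℝ} (hw : ∀ n, 0 ≤ w n)
    {s : ℝ} (hs : 0 < s) {J : ℕ}
    (hsum : ∑ j ∈ Finset.range J,
      Real.exp (-((2 ^ j : ℕ) * (w (2 ^ j) + s / 8) ^ 2 / (2 * C ^ 2))) ≤ 1 / 2) :
    R.real {ν | gap R ν < s / 8} / 2 ≤ (armLaw R).real (championSet R w s J) := by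
  have hm : MeasurableSet {ν | gap R ν < s / 8} := measurable_gap R measurableSet_Iio
  have key : ∀ᵐ ν ∂ R, {ν | gap R ν < s / 8}.indicator (fun _ => ENNReal.ofReal (1 / 2)) ν ≤
      sampleKernel ν (Prod.mk ν ⁻¹' championSet R w s J) := by
    filter_upwards [hbd] with ν hν
    by_cases h : ν ∈ {ν | gap R ν < s / 8}
    swap
    · rw [Set.indicator_of_notMem h]; exact zero_le
    rw [Set.indicator_of_mem h, ← ofReal_measureReal]
    refine ENNReal.ofReal_le_ofReal ?_
    have hms : MeasurableSet (Prod.mk ν ⁻¹' championSet R w s J) :=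
      measurable_prodMk_left (measurableSet_championSet w s J)
    have hcompl : (sampleKernel ν).real (Prod.mk ν ⁻¹' championSet R w s J)ᶜ ≤ 1 / 2 := by
      refine le_trans (measureReal_mono (s₂ := ⋃ j ∈ Finset.range J,
        {y | (∑ u ∈ Finset.range (2 ^ j), y u) / (2 ^ j : ℕ) ≤
          armMean ν - (w (2 ^ j) + s / 8)}) ?_ (measure_ne_top _ _)) ?_
      · intro y hy
        simp only [championSet, Set.preimage_ofPred_eq, Set.mem_compl_iff, Set.mem_ofPred_eq,
          not_and, not_forall, not_le] at hy
        obtain ⟨j, hj, hlt⟩ := hy h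
        simp only [Set.mem_iUnion, Finset.mem_range, Set.mem_ofPred_eq]
        refine ⟨j, hj, ?_⟩
        simp only [armIndex] at hlt
        have h' : gap R ν < s / 8 := h
        unfold gap at h'
        linarith
      · refine (measureReal_biUnion_finset_le _ _).trans (le_trans ?_ hsum)
        refine Finset.sum_le_sum fun j _ => ?_
        exact sampleKernel_real_mean_le_le hC hν (by positivity)
          (by have := hw (2 ^ j); positivity)
    rw [probReal_compl_eq_one_sub hms] at hcompl
    linarith
  have h1 : ENNReal.ofReal (1 / 2) * R {ν | gap R ν < s / 8} ≤ armLaw R (championSet R w s J) := by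
    unfold armLaw
    rw [Measure.compProd_apply (measurableSet_championSet w s J), ← lintegral_indicator_const hm]
    exact lintegral_mono_ae key
  have h2 := ENNReal.toReal_mono (measure_ne_top _ _) h1
  rw [ENNReal.toReal_mul, ENNReal.toReal_ofReal (by norm_num)] at h2
  simp only [measureReal_def]
  linarith

/-- Conditionally on the arm this is a union bound over the counts; the result is then integrated
over dyadic levels of the gap. -/
theorem exists_armLaw_overshootSet_le (hC : 0 < C) {β E₂ B : ℝ} (hβ : 0 < β)
    (hE₂ : 0 < E₂) (hB : 0 < B) :
    ∃ K : ℝ, 0 < K ∧ ∀ (R : Measure (ProbabilityMeasure ℝ)) [IsProbabilityMeasure R] (E₁ : ℝ),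
      BoundedArms R C → BetaRegular R β E₁ E₂ B →
      ∀ (D δ s M : ℝ) (I J : ℕ), 0 < D → 0 < δ → 0 < s → 2 * C < 2 ^ (I + 1) * s →
      (∀ i : ℕ, 2 * (1 + 256 * C + 32 * C ^ 2) * (1 + Real.posLog (D * (2 ^ i * s) ^ 2 / δ))
        ≤ M * (2 ^ i * s) ^ 2) →
      (armLaw R).real (overshootSet R (halfWidth C D δ) s M J) ≤
        ∑ i ∈ Finset.range (I + 1), K * Real.exp (-(M * (2 ^ i * s) ^ 2 / (32 * C ^ 2))) *
          ((E₂ + B ^ (-β)) * (2 ^ (i + 1) * s) ^ β) := by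
  obtain ⟨K, hK, htail⟩ := exists_sum_tail_le hC
  refine ⟨K, hK, fun R _ E₁ hbd hR D δ s M I J hD hδ hs hI hM => ?_⟩
  set w := halfWidth C D δ with hw
  set p : ProbabilityMeasure ℝ → ℕ → ℝ := fun ν j =>
    (sampleKernel ν).real {y | bestMean R - s / 4 ≤ armIndex w y (2 ^ j)} with hp
  have hm : MeasurableSet {ν | s ≤ gap R ν} := measurable_gap R measurableSet_Ici
  rw [measureReal_def]
  refine ENNReal.toReal_le_of_le_ofReal
    (Finset.sum_nonneg fun i _ => by positivity) ?_
  unfold armLaw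
  rw [Measure.compProd_apply (measurableSet_overshootSet w s M J)]
  have h1 : ∀ ν, sampleKernel ν (Prod.mk ν ⁻¹' overshootSet R w s M J) ≤
      {ν | s ≤ gap R ν}.indicator (fun ν => ENNReal.ofReal
        (∑ j ∈ Finset.range J, if M < 2 ^ (j + 1) then p ν j else 0)) ν := by
    intro ν
    by_cases h : ν ∈ {ν | s ≤ gap R ν}
    swap
    · rw [Set.indicator_of_notMem h]
      have : Prod.mk ν ⁻¹' overshootSet R w s M J = ∅ := by
        ext y
        simp only [overshootSet, Set.preimage_ofPred_eq, Set.mem_ofPred_eq,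
          Set.mem_empty_iff_false, iff_false]
        exact fun h' => h h'.1
      rw [this]; simp
    rw [Set.indicator_of_mem h, ← ofReal_measureReal]
    refine ENNReal.ofReal_le_ofReal ?_
    rw [← Finset.sum_filter]
    have hU := measureReal_biUnion_finset_le (μ := sampleKernel ν)
      ((Finset.range J).filter (fun j => M < 2 ^ (j + 1)))
      (fun j => {y | bestMean R - s / 4 ≤ armIndex w y (2 ^ j)})
    refine le_trans (measureReal_mono ?_ (measure_ne_top _ _)) hU
    rintro y ⟨_, j, hj, hMj, hle⟩
    simp only [Set.mem_iUnion, Finset.mem_filter, Finset.mem_range]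
    exact ⟨j, ⟨hj, hMj⟩, hle⟩
  refine (lintegral_mono h1).trans ?_
  rw [lintegral_indicator hm]
  refine setLIntegral_gap_le hβ hE₂ hB hbd hR hs hI (fun i => by positivity) ?_
  filter_upwards [hbd, ae_gap_le hbd] with ν hν hν2 i hi
  refine ENNReal.ofReal_le_ofReal ?_
  have hst : s ≤ 2 ^ i * s := by
    have : (1 : ℝ) ≤ 2 ^ i := one_le_pow₀ (by norm_num)
    nlinarith
  refine htail D δ (2 ^ i * s) M (p ν) hD hδ (by positivity) (hi.trans hν2) (hM i) ?_ J
  intro j hj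
  exact sampleKernel_real_le_armIndex hC hν hs hst hi (by positivity) hj

theorem integral_pullBound (w : ℕ → ℝ) (m : ℝ) (J : ℕ) (μ : Measure (ℕ → ℝ))
    [IsProbabilityMeasure μ] :
    Integrable (pullBound w m J) μ ∧ ∫ y, pullBound w m J y ∂μ =
      1 + ∑ j ∈ Finset.range J, 2 ^ j * μ.real {y | m ≤ armIndex w y (2 ^ j)} := by
  have hi : ∀ j ∈ Finset.range J, Integrable
      ({y | m ≤ armIndex w y (2 ^ j)}.indicator (fun _ => (2 : ℝ) ^ j)) μ := fun j _ =>
    (integrable_const _).indicator (measurableSet_le_armIndex w m _)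
  have hi' := integrable_finsetSum _ hi
  refine ⟨(integrable_const (1 : ℝ)).add hi', ?_⟩
  unfold pullBound
  rw [integral_add (integrable_const _) hi', integral_finsetSum _ hi]
  congr 1
  · simp
  · refine Finset.sum_congr rfl fun j _ => ?_
    rw [integral_indicator_const _ (measurableSet_le_armIndex w m _), smul_eq_mul, mul_comm]

theorem exists_integral_cappedPulls_le (hC : 0 < C) {β E₂ B : ℝ} (hβ : 0 < β)
    (hE₂ : 0 < E₂) (hB : 0 < B) :
    ∃ K : ℝ, 0 < K ∧ ∀ (R : Measure (ProbabilityMeasure ℝ)) [IsProbabilityMeasure R] (E₁ : ℝ),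
      BoundedArms R C → BetaRegular R β E₁ E₂ B →
      ∀ (D δ s M : ℝ) (I J : ℕ), 0 < D → 0 < δ → 0 < s → 0 < M → 2 * C < 2 ^ (I + 1) * s →
      ∫ a, cappedPulls R (halfWidth C D δ) s M J a ∂(armLaw R) ≤
        M * ((E₂ + B ^ (-β)) * s ^ β) + ∑ i ∈ Finset.range (I + 1),
          K * (1 + Real.posLog (D * (2 ^ i * s) ^ 2 / δ)) / (2 ^ i * s) ^ 2 *
          ((E₂ + B ^ (-β)) * (2 ^ (i + 1) * s) ^ β) := by
  obtain ⟨K, hK, hpull⟩ := exists_sum_two_pow_mul_le hC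
  refine ⟨K, hK, fun R _ E₁ hbd hR D δ s M I J hD hδ hs hM hI => ?_⟩
  set w := halfWidth C D δ with hw
  set p : ProbabilityMeasure ℝ → ℕ → ℝ := fun ν j =>
    (sampleKernel ν).real {y | bestMean R - s / 4 ≤ armIndex w y (2 ^ j)} with hp
  have hm : MeasurableSet {ν | s ≤ gap R ν} := measurable_gap R measurableSet_Ici
  have hm' : MeasurableSet {ν | gap R ν < s} := measurable_gap R measurableSet_Iio
  have hpos : ∀ i : ℕ, 0 ≤ K * (1 + Real.posLog (D * (2 ^ i * s) ^ 2 / δ)) / (2 ^ i * s) ^ 2 := by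
    intro i
    have := Real.posLog_nonneg (x := D * (2 ^ i * s) ^ 2 / δ)
    positivity
  have hmeas : Measurable fun a => ENNReal.ofReal (cappedPulls R w s M J a) :=
    (measurable_cappedPulls w s M J).ennreal_ofReal
  have hY0 : ∀ a, 0 ≤ cappedPulls R w s M J a := by
    intro a
    unfold cappedPulls
    split_ifs
    · exact hM.le
    · exact le_min (pullBound_nonneg _ _ _ _) hM.le
  rw [integral_eq_lintegral_of_nonneg_ae (Filter.Eventually.of_forall hY0)
    (measurable_cappedPulls w s M J).aestronglyMeasurable]
  refine ENNReal.toReal_le_of_le_ofReal (add_nonneg (by positivity)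
    (Finset.sum_nonneg fun i _ => mul_nonneg (hpos i) (by positivity))) ?_
  unfold armLaw
  rw [Measure.lintegral_compProd hmeas]
  have h1 : ∀ ν, ∫⁻ y, ENNReal.ofReal (cappedPulls R w s M J (ν, y)) ∂(sampleKernel ν) ≤
      {ν | gap R ν < s}.indicator (fun _ => ENNReal.ofReal M) ν +
      {ν | s ≤ gap R ν}.indicator (fun ν => ENNReal.ofReal
        (1 + ∑ j ∈ Finset.range J, 2 ^ j * p ν j)) ν := by
    intro ν
    by_cases h : gap R ν < s
    · rw [Set.indicator_of_mem (show ν ∈ {ν | gap R ν < s} from h)]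
      refine le_trans ?_ le_self_add
      simp [cappedPulls, h]
    · rw [Set.indicator_of_mem (show ν ∈ {ν | s ≤ gap R ν} from not_lt.1 h)]
      refine le_trans ?_ le_add_self
      obtain ⟨hint, heq⟩ := integral_pullBound w (bestMean R - s / 4) J (sampleKernel ν)
      simp only [hp]
      rw [← heq, ofReal_integral_eq_lintegral_ofReal hint
        (Filter.Eventually.of_forall fun y => pullBound_nonneg _ _ _ _)]
      refine lintegral_mono fun y => ENNReal.ofReal_le_ofReal ?_
      simp only [cappedPulls, h, if_false]
      exact min_le_left _ _
  refine (lintegral_mono h1).trans ?_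
  rw [lintegral_add_left (measurable_const.indicator hm'), lintegral_indicator_const hm',
    lintegral_indicator hm, ENNReal.ofReal_add (by positivity)
      (Finset.sum_nonneg fun i _ => mul_nonneg (hpos i) (by positivity)),
    ENNReal.ofReal_mul hM.le]
  refine add_le_add ?_ ?_
  · gcongr
    rw [← ofReal_measureReal]
    exact ENNReal.ofReal_le_ofReal (measureReal_gap_lt_le hβ hE₂ hB hR hs.le)
  refine setLIntegral_gap_le hβ hE₂ hB hbd hR hs hI hpos ?_
  filter_upwards [hbd, ae_gap_le hbd] with ν hν hν2 i hi
  refine ENNReal.ofReal_le_ofReal ?_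
  have hst : s ≤ 2 ^ i * s := by
    have : (1 : ℝ) ≤ 2 ^ i := one_le_pow₀ (by norm_num)
    nlinarith
  refine hpull D δ (2 ^ i * s) (p ν) hD hδ (by positivity) (hi.trans hν2)
    (fun j => measureReal_le_one) ?_ J
  intro j hj
  exact sampleKernel_real_le_armIndex hC hν hs hst hi (by positivity) hj

end OneArm

/-! ### Independent copies -/

section Copies

variable {X : Type*} [MeasurableSpace X] (P : Measure X) [IsProbabilityMeasure P]

theorem infinitePi_real_forall_notMem_le {G : Set X} (hG : MeasurableSet G) {p : ℝ}
    (hp : p ≤ P.real G) (N : ℕ) :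
    (Measure.infinitePi fun _ : ℕ => P).real {ω | ∀ k < N, ω k ∉ G} ≤ Real.exp (-(N * p)) := by
  have h1 : {ω : ℕ → X | ∀ k < N, ω k ∉ G} = (Finset.range N : Set ℕ).pi fun _ => Gᶜ := by
    ext ω; simp
  rw [measureReal_def, h1, Measure.infinitePi_pi _ fun _ _ => hG.compl]
  simp only [Finset.prod_const, Finset.card_range, ENNReal.toReal_pow]
  rw [← measureReal_def, probReal_compl_eq_one_sub hG]
  calc (1 - P.real G) ^ N ≤ Real.exp (-p) ^ N := by
        refine pow_le_pow_left₀ (by linarith [measureReal_le_one (μ := P) (s := G)]) ?_ N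
        linarith [Real.add_one_le_exp (-p)]
    _ = _ := by rw [← Real.exp_nat_mul]; congr 1; ring

theorem infinitePi_real_exists_mem_le {H : Set X} (hH : MeasurableSet H) (N : ℕ) :
    (Measure.infinitePi fun _ : ℕ => P).real {ω | ∃ k < N, ω k ∈ H} ≤ N * P.real H := by
  have h1 : {ω : ℕ → X | ∃ k < N, ω k ∈ H} = ⋃ k ∈ Finset.range N, (fun ω => ω k) ⁻¹' H := by
    ext ω; simp
  rw [h1]
  refine (measureReal_biUnion_finset_le _ _).trans_eq ?_
  have h2 : ∀ k : ℕ, (Measure.infinitePi fun _ : ℕ => P).real ((fun ω => ω k) ⁻¹' H) = P.real H := by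
    intro k
    rw [← map_measureReal_apply (measurable_pi_apply k) hH, Measure.infinitePi_map_eval]
  simp [h2]

/-- Chernoff bound at parameter `1 / M`: as `exp u ≤ 1 + 2 u` on `[0, 1]`, the moment generating
function of the sum is at most `exp (T / (2 M))`. -/
theorem infinitePi_real_le_sum_le {Y : X → ℝ} (hY : Measurable Y) {M : ℝ} (hM : 0 < M)
    (hY0 : ∀ x, 0 ≤ Y x) (hYM : ∀ x, Y x ≤ M) {N : ℕ} {T : ℝ} (hT : N * ∫ x, Y x ∂P ≤ T / 4) :
    (Measure.infinitePi fun _ : ℕ => P).real {ω | T ≤ ∑ k ∈ Finset.range N, Y (ω k)}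
      ≤ Real.exp (-(T / (2 * M))) := by
  set Q := Measure.infinitePi fun _ : ℕ => P with hQ
  set Z : ℕ → (ℕ → X) → ℝ := fun k ω => Y (ω k) with hZ
  have hZm : ∀ k, Measurable (Z k) := fun k => hY.comp (measurable_pi_apply k)
  have hind : iIndepFun Z Q := iIndepFun_infinitePi (X := fun _ : ℕ => Y) fun _ => hY
  have hYint : Integrable Y P := Integrable.of_mem_Icc 0 M hY.aemeasurable
    (Filter.Eventually.of_forall fun x => ⟨hY0 x, hYM x⟩)
  have hmgf : ∀ k, mgf (Z k) Q (1 / M) ≤ Real.exp (2 / M * ∫ x, Y x ∂P) := by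
    intro k
    have h1 : mgf (Z k) Q (1 / M) = ∫ x, Real.exp (1 / M * Y x) ∂P := by
      have h2 : Q.map (fun ω => ω k) = P := Measure.infinitePi_map_eval _ k
      conv_rhs => rw [← h2]
      rw [integral_map (measurable_pi_apply k).aemeasurable
        (by fun_prop)]
      rfl
    rw [h1]
    have hb : ∀ x, Real.exp (1 / M * Y x) ≤ 1 + 2 / M * Y x := by
      intro x
      set u := 1 / M * Y x with hu
      have hu0 : 0 ≤ u := mul_nonneg (by positivity) (hY0 x)
      have hu1 : u ≤ 1 := by
        rw [hu, one_div, inv_mul_le_iff₀ hM]; linarith [hYM x]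
      have h3 := Real.abs_exp_sub_one_sub_id_le (x := u) (by rw [abs_of_nonneg hu0]; exact hu1)
      have h4 := (abs_le.1 h3).2
      have h5 : 2 / M * Y x = 2 * u := by rw [hu]; ring
      rw [h5]; nlinarith
    have hint : Integrable (fun x => Real.exp (1 / M * Y x)) P :=
      integrable_exp_mul_of_mem_Icc hY.aemeasurable
        (Filter.Eventually.of_forall fun x => ⟨hY0 x, hYM x⟩)
    calc _ ≤ ∫ x, (1 + 2 / M * Y x) ∂P :=
          integral_mono hint ((integrable_const _).add (hYint.const_mul _)) hb
      _ = 2 / M * ∫ x, Y x ∂P + 1 := by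
          rw [integral_add (integrable_const _) (hYint.const_mul _), integral_const_mul]
          simp [add_comm]
      _ ≤ _ := Real.add_one_le_exp _
  have hsumeq : ∀ ω, (∑ k ∈ Finset.range N, Z k) ω = ∑ k ∈ Finset.range N, Y (ω k) := by
    intro ω; simp [hZ, Finset.sum_apply]
  have hmem : ∀ᵐ ω ∂Q, (∑ k ∈ Finset.range N, Z k) ω ∈ Set.Icc 0 (N * M) := by
    refine Filter.Eventually.of_forall fun ω => ?_
    rw [hsumeq]
    refine ⟨Finset.sum_nonneg fun k _ => hY0 _, ?_⟩
    exact (Finset.sum_le_sum fun k _ => hYM (ω k)).trans_eq (by simp)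
  have hmeas : Measurable (∑ k ∈ Finset.range N, Z k) := by
    rw [funext hsumeq]
    exact Finset.measurable_sum _ fun k _ => hZm k
  have hchern := measure_ge_le_exp_mul_mgf (μ := Q) (X := ∑ k ∈ Finset.range N, Z k)
    (t := 1 / M) T (by positivity)
    (integrable_exp_mul_of_mem_Icc hmeas.aemeasurable hmem)
  simp only [hsumeq] at hchern
  refine hchern.trans ?_
  rw [hind.mgf_sum hZm]
  calc _ ≤ Real.exp (-(1 / M) * T) * ∏ k ∈ Finset.range N, Real.exp (2 / M * ∫ x, Y x ∂P) := by
        gcongr with k _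
        · exact fun _ _ => mgf_nonneg
        · exact hmgf k
    _ = Real.exp (-(1 / M) * T + 2 / M * (N * ∫ x, Y x ∂P)) := by
        rw [Finset.prod_const, Finset.card_range, ← Real.exp_nat_mul, ← Real.exp_add]
        congr 1; ring
    _ ≤ _ := by
        gcongr
        have : 2 / M * (N * ∫ x, Y x ∂P) ≤ 2 / M * (T / 4) := by gcongr
        calc _ ≤ -(1 / M) * T + 2 / M * (T / 4) := by gcongr
          _ = _ := by field_simp; ring

end Copies

/-! ### Runs of the algorithm -/

section Runs

variable {A β C δ : ℝ} {T : ℕ} {ω : Outcome}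

theorem index_eq_armIndex (A β C δ : ℝ) (T : ℕ) (ω : Outcome) (k n : ℕ) :
    index A β C δ T ω k n = armIndex
      (halfWidth C ((2 : ℝ) ^ (2 * (logArms A β T : ℝ) / min β 2)) δ) (ω k).2 n := by
  simp only [index, armIndex, halfWidth, empMean, confLog]
  ring

theorem Reachable.one_le {n : Fin (numArms A β T) → ℕ} (h : Reachable A β C δ T ω n) (k) :
    1 ≤ n k := by
  induction h with
  | init => exact le_rfl
  | pull n k' _ _ _ ih =>
    rcases eq_or_ne k k' with rfl | hk
    · rw [Function.update_self]; omega
    · rwa [Function.update_of_ne hk]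

theorem Reachable.exists_terminal [Nonempty (Fin (numArms A β T))] (d : ℕ) :
    ∀ n : Fin (numArms A β T) → ℕ, Reachable A β C δ T ω n → T + 1 - ∑ j, n j ≤ d →
      ∃ n', Reachable A β C δ T ω n' ∧ T < ∑ j, n' j := by
  induction d with
  | zero => exact fun n hn hd => ⟨n, hn, by omega⟩
  | succ d ih =>
    intro n hn hd
    rcases lt_or_ge T (∑ j, n j) with h | h
    · exact ⟨n, hn, h⟩
    obtain ⟨k, hk⟩ := Finite.exists_max fun j : Fin (numArms A β T) => index A β C δ T ω j (n j)
    refine ih _ (Reachable.pull n k hn h hk) ?_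
    have h1 : ∑ j, n j < ∑ j, Function.update n k (n k + n k) j := by
      refine Finset.sum_lt_sum (fun j _ => ?_) ⟨k, Finset.mem_univ k, ?_⟩
      · rcases eq_or_ne j k with rfl | hj
        · rw [Function.update_self]; omega
        · rw [Function.update_of_ne hj]
      · rw [Function.update_self]; have := hn.one_le k; omega
    omega

theorem exists_isOutput (A β C δ : ℝ) (T : ℕ) (ω : Outcome) (hN : 0 < numArms A β T) :
    ∃ k, IsOutput A β C δ T ω k := by
  have : Nonempty (Fin (numArms A β T)) := ⟨⟨0, hN⟩⟩
  obtain ⟨n, hn, hT⟩ := Reachable.exists_terminal (A := A) (β := β) (C := C) (δ := δ)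
    (T := T) (ω := ω) _ _
    Reachable.init le_rfl
  obtain ⟨k, hk⟩ := Finite.exists_max n
  exact ⟨k, n, hn, hT, hk⟩

/-- An arm is doubled only when its index is maximal, hence at least that of `k₀`, which never falls
below `m`. The bound `i < T` holds since `2 ^ i ≤ T` at the moment of doubling. -/
theorem Reachable.exists_pow {n : Fin (numArms A β T) → ℕ} (h : Reachable A β C δ T ω n) {m : ℝ}
    {k₀ : Fin (numArms A β T)} (hk₀ : ∀ e < T, m ≤ index A β C δ T ω k₀ (2 ^ e)) (k) :
    ∃ e, n k = 2 ^ e ∧ ∀ i < e, i < T ∧ m ≤ index A β C δ T ω k (2 ^ i) := by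
  induction h generalizing k with
  | init => exact ⟨0, rfl, by simp⟩
  | pull n k' _ hT hmax ih =>
    rcases eq_or_ne k k' with rfl | hk
    · rw [Function.update_self]
      obtain ⟨e, he, hi⟩ := ih k
      obtain ⟨e₀, he₀, -⟩ := ih k₀
      have hle : ∀ j e, n j = 2 ^ e → e < T := by
        intro j e hj
        have h1 : n j ≤ ∑ j, n j := Finset.single_le_sum (fun _ _ => Nat.zero_le _)
          (Finset.mem_univ j)
        have h2 : e < 2 ^ e := Nat.lt_two_pow_self
        omega
      refine ⟨e + 1, by rw [he, pow_succ]; omega, fun i hie => ?_⟩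
      rcases Nat.lt_succ_iff_lt_or_eq.1 hie with h1 | rfl
      · exact hi i h1
      · refine ⟨hle k i he, ?_⟩
        have h3 := hmax k₀
        rw [he₀, he] at h3
        exact (hk₀ e₀ (hle k₀ e₀ he₀)).trans h3
    · rw [Function.update_of_ne hk]
      exact ih k

theorem gap_lt_of_isOutput {R : Measure (ProbabilityMeasure ℝ)} {w : ℕ → ℝ}
    (hw : w = halfWidth C ((2 : ℝ) ^ (2 * (logArms A β T : ℝ) / min β 2)) δ) {s M : ℝ}
    (hM : 1 ≤ M)
    (h₁ : ∃ k < numArms A β T, ω k ∈ championSet R w s T)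
    (h₂ : ∀ k < numArms A β T, ω k ∉ overshootSet R w s M T)
    (h₃ : ∑ k ∈ Finset.range (numArms A β T), cappedPulls R w s M T (ω k) < T)
    (k : Fin (numArms A β T)) (hk : IsOutput A β C δ T ω k) : gap R (ω k).1 < s := by
  obtain ⟨n, hn, hT, hmax⟩ := hk
  obtain ⟨k₀, hk₀N, hk₀⟩ := h₁
  by_contra! hgap
  set m := bestMean R - s / 4 with hm
  have hidx : ∀ (k n : ℕ), index A β C δ T ω k n = armIndex w (ω k).2 n := by
    intro k n; rw [hw]; exact index_eq_armIndex A β C δ T ω k n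
  have hpow := hn.exists_pow (m := m) (k₀ := ⟨k₀, hk₀N⟩)
    fun e he => (hk₀.2 e he).trans_eq (hidx _ _).symm
  have hnM : (n k : ℝ) ≤ M := by
    obtain ⟨e, he, hi⟩ := hpow k
    rw [he]
    rcases e with _ | e
    · simpa using hM
    · by_contra! hlt
      push_cast at hlt
      obtain ⟨heT, hle⟩ := hi e (by omega)
      exact h₂ k k.2 ⟨hgap, e, heT, hlt, by rw [← hidx]; exact hle⟩
  have hnY : ∀ j : Fin (numArms A β T), (n j : ℝ) ≤ cappedPulls R w s M T (ω j) := by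
    intro j
    have hjM : (n j : ℝ) ≤ M := le_trans (by exact_mod_cast hmax j) hnM
    unfold cappedPulls
    split_ifs
    · exact hjM
    refine le_min ?_ hjM
    obtain ⟨e, he, hi⟩ := hpow j
    -- The initial pull plus all doublings: each summand `2 ^ i` is counted by `pullBound`, the
    -- index being above `m` at that count.
    have hgeom : (2 : ℝ) ^ e = 1 + ∑ i ∈ Finset.range e, (2 : ℝ) ^ i := by
      rw [geom_sum_eq (by norm_num)]; ring
    rw [he]; push_cast
    rw [hgeom, pullBound]
    gcongr
    have heT : Finset.range e ⊆ Finset.range T := fun i hie =>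
      Finset.mem_range.2 (hi i (Finset.mem_range.1 hie)).1
    refine le_trans (Finset.sum_le_sum fun i hie => ?_) (Finset.sum_le_sum_of_subset_of_nonneg heT
      fun i _ _ => Set.indicator_nonneg (fun _ _ => by positivity) _)
    have h1 := (hi i (Finset.mem_range.1 hie)).2
    rw [hidx] at h1
    rw [Set.indicator_of_mem (show (ω j).2 ∈ {y | m ≤ armIndex w y (2 ^ i)} from h1)]
  have hsum : (T : ℝ) < ∑ j, (n j : ℝ) := by exact_mod_cast hT
  have h4 : ∑ j, (n j : ℝ) ≤ ∑ j : Fin (numArms A β T), cappedPulls R w s M T (ω j) :=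
    Finset.sum_le_sum fun j _ => hnY j
  rw [Fin.sum_univ_eq_sum_range (fun k => cappedPulls R w s M T (ω k))] at h4
  linarith

end Runs

/-! ### The regret bound in terms of the parameters -/

theorem le_exp_posLog (x : ℝ) (hx : 0 ≤ x) : x ≤ Real.exp (Real.posLog x) := by
  rw [Real.posLog_eq_log_max_one hx, Real.exp_log (lt_max_of_lt_left one_pos)]
  exact le_max_right _ _

theorem posLog_four_pow_mul_le (i : ℕ) (x : ℝ) :
    Real.posLog (4 ^ i * x) ≤ 2 * i + Real.posLog x := by
  have h4 : Real.posLog 4 ≤ 2 := by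
    rw [Real.posLog_eq_log (by norm_num), show (4 : ℝ) = 2 ^ 2 by norm_num, Real.log_pow]
    have := Real.log_two_lt_d9
    push_cast; linarith
  refine Real.posLog_mul.trans ?_
  rw [Real.posLog_pow]
  nlinarith [Nat.cast_nonneg (α := ℝ) i]

theorem two_pow_mul_sq (i : ℕ) (s : ℝ) : ((2 : ℝ) ^ i * s) ^ 2 = 4 ^ i * s ^ 2 := by
  rw [mul_pow, ← pow_mul, mul_comm i 2, pow_mul]; norm_num

/-- Here `V` stands for `D s ^ 2 / δ`. The expected number of overshooting arms is of order `N s ^ β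
exp (-κ Λ / c)`, and `N s ^ β ≤ 2 V δ ≤ 2 δ exp (Λ - 1)`, so a large `κ` absorbs the factor `exp Λ`
and leaves `δ / 4`. -/
theorem exists_sum_overshoot_le {β E K c : ℝ} (hβ : 0 < β) (hE : 0 < E) (hK : 0 < K) (hc : 0 < c)  :
    ∃ κ₀ : ℝ, 1 ≤ κ₀ ∧ ∀ κ : ℝ, κ₀ ≤ κ → ∀ (N V δ s : ℝ) (I : ℕ), 0 ≤ N → 0 < δ → 0 ≤ V → 0 < s →
      N * s ^ β ≤ 2 * (V * δ) →
      N * ∑ i ∈ Finset.range (I + 1), K * Real.exp (-(κ * (1 + Real.posLog V) / s ^ 2 *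
        (2 ^ i * s) ^ 2 / c)) * (E * (2 ^ (i + 1) * s) ^ β) ≤ δ / 4 := by
  obtain ⟨G, hG, hsum⟩ := exists_sum_rpow_mul_exp_neg_le (q := 4) (γ := β / 2) (by norm_num)
    (by positivity)
  set H : ℝ := K * E * 2 ^ β * G * Real.exp 1 with hH
  have hH0 : 0 < H := by positivity
  refine ⟨1 + c * (1 + 8 * H), by nlinarith [mul_pos hc hH0], fun κ hκ N V δ s I hN hδ hV hs hQ => ?_⟩
  set Λ := 1 + Real.posLog V with hΛ
  have hΛ1 : 1 ≤ Λ := by rw [hΛ]; linarith [Real.posLog_nonneg (x := V)]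
  set ψ := κ * Λ / c with hψ
  have hψ1 : (1 + 8 * H) * Λ ≤ ψ := by
    rw [hψ, le_div_iff₀ hc]
    nlinarith
  have hψ2 : 1 ≤ ψ := by nlinarith
  have hterm : ∀ i : ℕ, K * Real.exp (-(κ * Λ / s ^ 2 * (2 ^ i * s) ^ 2 / c)) *
      (E * (2 ^ (i + 1) * s) ^ β) ≤ K * E * 2 ^ β * Real.exp (1 - ψ) * s ^ β *
        ((4 ^ i * 1) ^ (β / 2) * Real.exp (-(4 ^ i * 1))) := by
    intro i
    have h4 : (1 : ℝ) ≤ 4 ^ i := one_le_pow₀ (by norm_num)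
    have h1 : κ * Λ / s ^ 2 * (2 ^ i * s) ^ 2 / c = ψ * 4 ^ i := by
      rw [two_pow_mul_sq, hψ]; field_simp
    have h2 : ((2 : ℝ) ^ (i + 1) * s) ^ β = 2 ^ β * s ^ β * (4 ^ i * 1) ^ (β / 2) := by
      have h3 : (4 : ℝ) ^ i * 1 = (2 ^ i) ^ (2 : ℝ) := by
        rw [mul_one, Real.rpow_two, ← pow_mul, mul_comm i 2, pow_mul]; norm_num
      rw [h3, ← Real.rpow_mul (by positivity), show 2 * (β / 2) = β by ring, pow_succ,
        Real.mul_rpow (by positivity) hs.le, Real.mul_rpow (by positivity) (by norm_num)]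
      ring
    have h3 : Real.exp (-(ψ * 4 ^ i)) ≤ Real.exp (1 - ψ) * Real.exp (-(4 ^ i * 1)) := by
      rw [← Real.exp_add]
      gcongr
      nlinarith
    rw [h1, h2]
    calc _ ≤ K * (Real.exp (1 - ψ) * Real.exp (-(4 ^ i * 1))) *
          (E * (2 ^ β * s ^ β * (4 ^ i * 1) ^ (β / 2))) := by gcongr
      _ = _ := by ring
  have hexp : Real.exp (Λ - 1 - ψ) * (8 * H) ≤ 1 := by
    have h1 : Real.exp (Λ - 1 - ψ) ≤ Real.exp (-(8 * H)) := by
      gcongr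
      nlinarith
    have h2 : 8 * H ≤ Real.exp (8 * H) := by linarith [Real.add_one_le_exp (8 * H)]
    calc _ ≤ Real.exp (-(8 * H)) * Real.exp (8 * H) := by gcongr
      _ = 1 := by rw [← Real.exp_add]; simp
  calc _ ≤ N * ∑ i ∈ Finset.range (I + 1), K * E * 2 ^ β * Real.exp (1 - ψ) * s ^ β *
        ((4 ^ i * 1) ^ (β / 2) * Real.exp (-(4 ^ i * 1))) := by
        exact mul_le_mul_of_nonneg_left (Finset.sum_le_sum fun i _ => hterm i) hN
    _ ≤ N * (K * E * 2 ^ β * Real.exp (1 - ψ) * s ^ β * G) := by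
        rw [← Finset.mul_sum]
        gcongr
        exact hsum 1 one_pos (I + 1)
    _ = (N * s ^ β) * (H * Real.exp (-ψ)) := by
        rw [hH, sub_eq_add_neg, Real.exp_add]; ring
    _ ≤ 2 * (Real.exp (Λ - 1) * δ) * (H * Real.exp (-ψ)) := by
        refine mul_le_mul_of_nonneg_right (hQ.trans ?_) (by positivity)
        gcongr
        rw [hΛ, add_sub_cancel_left]
        exact le_exp_posLog V hV
    _ = δ / 4 * (Real.exp (Λ - 1 - ψ) * (8 * H)) := by
        rw [sub_eq_add_neg (Λ - 1) ψ, Real.exp_add]; ring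
    _ ≤ δ / 4 * 1 := by gcongr
    _ = δ / 4 := mul_one _

set_option maxHeartbeats 1600000 in
-- All probability ends here: what remains is to choose `N` and `s` satisfying these deterministic
-- inequalities.
theorem exists_lt_real_regretAtMost {β E₁ E₂ B C : ℝ} (hβ : 0 < β) (hE₁ : 0 < E₁) (hE₂ : 0 < E₂)
    (hB : 0 < B) (hB1 : B < 1) (hC : 0 < C) :
    ∃ K₁ K₂ : ℝ, 0 < K₁ ∧ 0 < K₂ ∧
      ∀ (R : Measure (ProbabilityMeasure ℝ)) [IsProbabilityMeasure R],
        BoundedArms R C → BetaRegular R β E₁ E₂ B →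
        ∀ (A δ s D : ℝ) (T I N : ℕ), N = numArms A β T →
          D = (2 : ℝ) ^ (2 * (logArms A β T : ℝ) / min β 2) →
          0 < δ → δ ≤ 1 → 0 < s → s ≤ B → K₁ * Real.log (4 / δ) ≤ N * s ^ β →
          N * s ^ β ≤ 2 * (D * s ^ 2) → 2 * C < 2 ^ (I + 1) * s →
          K₂ * (N * ∑ i ∈ Finset.range (I + 1),
            (2 ^ i * s) ^ (β - 2) * (1 + Real.posLog (D * s ^ 2 / δ) + i)) ≤ T →
          1 - δ < (banditLaw R).real (RegretAtMost R A β C δ T s) := by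
  obtain ⟨V, hV, hchamp⟩ := exists_sum_exp_halfWidth_le hC
  obtain ⟨Ka, hKa, hover⟩ := exists_armLaw_overshootSet_le hC hβ hE₂ hB
  obtain ⟨Kb, hKb, hcap⟩ := exists_integral_cappedPulls_le hC hβ hE₂ hB
  set E := E₂ + B ^ (-β) with hE
  have hE0 : 0 < E := by positivity
  obtain ⟨κ₀, hκ₀, hsumover⟩ := exists_sum_overshoot_le hβ hE0 hKa
    (show 0 < 32 * C ^ 2 by positivity)
  -- The first summand makes the overshoot probability small; the second puts `M` beyond twice the
  -- count at which the width is small, at every dyadic level.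
  set κ : ℝ := κ₀ + 2 * (1 + 256 * C + 32 * C ^ 2) with hκ
  have hκ1 : 1 ≤ κ := by rw [hκ]; nlinarith
  -- `2 * V` ensures `V ≤ D s ^ 2 / δ`, through `N s ^ β ≤ 2 D s ^ 2` and `δ ≤ 1`. The other term
  -- compensates the lower bound `E₁ (s / 8) ^ β / 2` for the probability of a champion.
  set K₁ : ℝ := 2 * V + 2 * 8 ^ β / E₁ with hK₁
  have hK₁0 : 0 < K₁ := by positivity
  -- The first term brings the mean of the capped pulls down to `T / 4`; the second yields `T ≥ 2 M
  -- log (4 / δ)` for the Chernoff bound.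
  set K₂ : ℝ := 4 * E * (κ + 2 * Kb * 2 ^ β) + 2 * κ / K₁ with hK₂
  refine ⟨K₁, K₂, hK₁0, by positivity, ?_⟩
  intro R _ hbd hR A δ s D T I N hN hD hδ hδ1 hs hsB hQ hQD hI hT
  have hD0 : 0 < D := by rw [hD]; positivity
  have hs1 : s < 1 := by linarith
  set Λ := 1 + Real.posLog (D * s ^ 2 / δ) with hΛ
  have hΛ1 : 1 ≤ Λ := by rw [hΛ]; linarith [Real.posLog_nonneg (x := D * s ^ 2 / δ)]
  set L := Real.log (4 / δ) with hL
  have hL1 : 1 ≤ L := by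
    have h1 : Real.log 4 ≤ L := Real.log_le_log (by norm_num) (by
      rw [le_div_iff₀ hδ]; linarith)
    have h2 : Real.log 4 = 2 * Real.log 2 := by
      rw [show (4 : ℝ) = 2 ^ 2 by norm_num, Real.log_pow]; norm_num
    linarith [Real.log_two_gt_d9]
  have hexpL : Real.exp (-L) = δ / 4 := by
    rw [hL, Real.exp_neg, Real.exp_log (by positivity), inv_div]
  have hV0 : 2 * V ≤ K₁ := by rw [hK₁]; linarith [show 0 < 2 * 8 ^ β / E₁ by positivity]
  have hV1 : 2 * 8 ^ β / E₁ ≤ K₁ := by rw [hK₁]; linarith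
  have hK₁Q : K₁ ≤ N * s ^ β := by nlinarith
  set w := halfWidth C D δ with hw
  set M := κ * Λ / s ^ 2 with hM
  have hM1 : 1 ≤ M := by
    rw [hM, le_div_iff₀ (by positivity)]
    nlinarith
  have hM0 : 0 < M := by linarith
  set P := banditLaw R with hP
  -- a champion exists
  have hb1 : P.real {ω | ∀ k < N, ω k ∉ championSet R w s T} ≤ δ / 4 := by
    have h1 := hchamp D δ s hD0 hδ hs (by
      rw [le_div_iff₀ hδ]; nlinarith) T
    have h2 := armLaw_championSet_ge hC hbd (halfWidth_nonneg hC D δ) hs h1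
    have h3 := infinitePi_real_forall_notMem_le (armLaw R) (measurableSet_championSet w s T) h2 N
    refine h3.trans ?_
    rw [← hexpL]
    refine Real.exp_le_exp.2 (neg_le_neg ?_)
    have h4 := (hR (s / 8) (by positivity) (by linarith)).1
    rw [← measureReal_gap_lt] at h4
    have h5 : E₁ * (s / 8) ^ β = E₁ / 8 ^ β * s ^ β := by
      rw [Real.div_rpow hs.le (by norm_num)]; ring
    rw [h5] at h4
    have h6 : L ≤ N * (E₁ / 8 ^ β * s ^ β / 2) := by
      have h7 : 2 * 8 ^ β / E₁ * L ≤ N * s ^ β := le_trans (by gcongr) hQ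
      calc L = E₁ / (2 * 8 ^ β) * (2 * 8 ^ β / E₁ * L) := by field_simp
        _ ≤ E₁ / (2 * 8 ^ β) * (N * s ^ β) := by gcongr
        _ = _ := by ring
    refine h6.trans ?_
    gcongr
  -- no bad arm is pulled more than `M` times
  have hb2 : P.real {ω | ∃ k < N, ω k ∈ overshootSet R w s M T} ≤ δ / 4 := by
    refine (infinitePi_real_exists_mem_le (armLaw R) (measurableSet_overshootSet w s M T) N).trans ?_
    have h1 := hover R E₁ hbd hR D δ s M I T hD0 hδ hs hI (by
      intro i
      rw [two_pow_mul_sq, hM]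
      have h2 : κ * Λ / s ^ 2 * (4 ^ i * s ^ 2) = κ * Λ * 4 ^ i := by field_simp
      have h3 : D * (4 ^ i * s ^ 2) / δ = 4 ^ i * (D * s ^ 2 / δ) := by ring
      rw [h2, h3]
      have h4 := posLog_four_pow_mul_le i (D * s ^ 2 / δ)
      have h5 : 1 + (i : ℝ) * 3 ≤ (1 + 3) ^ i := one_add_mul_le_pow (by norm_num) i
      have h6 : 1 + Real.posLog (4 ^ i * (D * s ^ 2 / δ)) ≤ Λ * 4 ^ i := by
        rw [show (1 : ℝ) + 3 = 4 by norm_num] at h5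
        have h7 : Λ * (1 + (i : ℝ) * 3) ≤ Λ * 4 ^ i :=
          mul_le_mul_of_nonneg_left h5 (by linarith)
        have h8 : 0 ≤ (Λ - 1) * i := mul_nonneg (by linarith) (Nat.cast_nonneg i)
        linarith [Nat.cast_nonneg (α := ℝ) i]
      calc _ ≤ κ * (Λ * 4 ^ i) := by
            refine mul_le_mul (by rw [hκ]; linarith) h6 ?_ (by positivity)
            linarith [Real.posLog_nonneg (x := 4 ^ i * (D * s ^ 2 / δ))]
        _ = _ := by ring)
    refine (mul_le_mul_of_nonneg_left h1 (Nat.cast_nonneg N)).trans ?_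
    refine hsumover κ (by rw [hκ]; nlinarith) N (D * s ^ 2 / δ) δ s I (Nat.cast_nonneg N) hδ
      (by positivity) hs ?_
    rw [div_mul_cancel₀ _ hδ.ne']; exact hQD
  -- the total number of pulls of bad arms is small
  set S := ∑ i ∈ Finset.range (I + 1), (2 ^ i * s) ^ (β - 2) * (Λ + i) with hS
  have hS0 : s ^ (β - 2) * Λ ≤ S := by
    have h1 := Finset.single_le_sum (s := Finset.range (I + 1))
      (f := fun i : ℕ => (2 ^ i * s) ^ (β - 2) * (Λ + i)) (fun i _ => by positivity)
      (Finset.mem_range.2 (Nat.succ_pos I))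
    simpa using h1
  have hs2 : ∀ t : ℝ, 0 < t → t ^ (β - 2) = t ^ β / t ^ 2 := fun t ht => by
    rw [Real.rpow_sub ht, Real.rpow_two]
  have hb3 : P.real {ω | (T : ℝ) ≤ ∑ k ∈ Finset.range N, cappedPulls R w s M T (ω k)} ≤ δ / 4 := by
    have h1 : N * ∫ a, cappedPulls R w s M T a ∂(armLaw R) ≤ (T : ℝ) / 4 := by
      have h2 := hcap R E₁ hbd hR D δ s M I T hD0 hδ hs hM0 hI
      have h3 : M * (E * s ^ β) ≤ E * κ * S := by
        calc _ = E * κ * (s ^ (β - 2) * Λ) := by rw [hM, hs2 s hs]; ring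
          _ ≤ _ := by gcongr
      have h4 : ∑ i ∈ Finset.range (I + 1),
          Kb * (1 + Real.posLog (D * (2 ^ i * s) ^ 2 / δ)) / (2 ^ i * s) ^ 2 *
          (E * (2 ^ (i + 1) * s) ^ β) ≤ E * (2 * Kb * 2 ^ β) * S := by
        rw [hS, Finset.mul_sum]
        refine Finset.sum_le_sum fun i _ => ?_
        have h5 : 1 + Real.posLog (D * (2 ^ i * s) ^ 2 / δ) ≤ 2 * (Λ + i) := by
          have h6 := posLog_four_pow_mul_le i (D * s ^ 2 / δ)
          have h3 : D * (2 ^ i * s) ^ 2 / δ = 4 ^ i * (D * s ^ 2 / δ) := by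
            rw [two_pow_mul_sq]; ring
          rw [h3]; linarith
        have h7 : ((2 : ℝ) ^ (i + 1) * s) ^ β = 2 ^ β * (2 ^ i * s) ^ β := by
          rw [← Real.mul_rpow (by norm_num) (by positivity)]; congr 1; ring
        rw [h7, hs2 _ (by positivity)]
        calc _ ≤ Kb * (2 * (Λ + i)) / (2 ^ i * s) ^ 2 * (E * (2 ^ β * (2 ^ i * s) ^ β)) := by
              gcongr
          _ = _ := by ring
      have h5 : N * ∫ a, cappedPulls R w s M T a ∂(armLaw R) ≤
          N * (E * (κ + 2 * Kb * 2 ^ β) * S) := by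
        gcongr
        calc _ ≤ _ := h2
          _ ≤ E * κ * S + E * (2 * Kb * 2 ^ β) * S := add_le_add h3 h4
          _ = _ := by ring
      have h6 : 4 * E * (κ + 2 * Kb * 2 ^ β) * (N * S) ≤ T := by
        refine le_trans ?_ hT
        have : 0 ≤ N * S := mul_nonneg (Nat.cast_nonneg N) (le_trans (by positivity) hS0)
        gcongr
        rw [hK₂]; linarith [show 0 < 2 * κ / K₁ by positivity]
      linarith
    have hY0 : ∀ a, 0 ≤ cappedPulls R w s M T a ∧ cappedPulls R w s M T a ≤ M := by
      intro a
      unfold cappedPulls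
      split_ifs
      · exact ⟨hM0.le, le_rfl⟩
      · exact ⟨le_min (pullBound_nonneg _ _ _ _) hM0.le, min_le_right _ _⟩
    refine (infinitePi_real_le_sum_le (armLaw R) (measurable_cappedPulls w s M T) hM0
      (fun a => (hY0 a).1) (fun a => (hY0 a).2) h1).trans ?_
    rw [← hexpL]
    refine Real.exp_le_exp.2 (neg_le_neg ?_)
    rw [le_div_iff₀ (by positivity)]
    have h2 : 2 * κ / K₁ * (N * S) ≤ T := by
      refine le_trans ?_ hT
      have : 0 ≤ N * S := mul_nonneg (Nat.cast_nonneg N) (le_trans (by positivity) hS0)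
      gcongr
      rw [hK₂]; linarith [show 0 < 4 * E * (κ + 2 * Kb * 2 ^ β) by positivity]
    refine le_trans ?_ h2
    calc L * (2 * M) = 2 * κ / K₁ * (K₁ * L * (Λ / s ^ 2)) := by rw [hM]; field_simp
      _ ≤ 2 * κ / K₁ * (N * s ^ β * (Λ / s ^ 2)) := by gcongr
      _ = 2 * κ / K₁ * (N * (s ^ (β - 2) * Λ)) := by rw [hs2 s hs]; ring
      _ ≤ _ := by gcongr
  have hN0 : 0 < numArms A β T := by
    rw [← hN]
    rcases Nat.eq_zero_or_pos N with h | h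
    · rw [h] at hK₁Q; simp at hK₁Q; linarith
    · exact h
  have hsub : (Set.univ : Set Outcome) ⊆ RegretAtMost R A β C δ T s ∪
      ({ω | ∀ k < N, ω k ∉ championSet R w s T} ∪ ({ω | ∃ k < N, ω k ∈ overshootSet R w s M T} ∪
        {ω | (T : ℝ) ≤ ∑ k ∈ Finset.range N, cappedPulls R w s M T (ω k)})) := by
    intro ω _
    by_contra! h
    simp only [Set.mem_union, not_or, Set.mem_ofPred_eq] at h
    obtain ⟨h0, h1, h2, h3⟩ := h
    push Not at h1 h2 h3
    apply h0
    refine ⟨exists_isOutput A β C δ T ω hN0, fun k hk => ?_⟩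
    have := gap_lt_of_isOutput (R := R) (w := w) (by rw [hw, hD]) hM1 (by rw [← hN]; exact h1)
      (by rw [← hN]; exact h2) (by rw [← hN]; exact h3) k hk
    exact this.le
  have huniv : P.real (Set.univ : Set Outcome) = 1 := by
    have : IsProbabilityMeasure P := by rw [hP]; unfold banditLaw; infer_instance
    simp
  have hfin : IsFiniteMeasure P := by rw [hP]; unfold banditLaw; infer_instance
  have h1 := measureReal_mono hsub (measure_ne_top P _)
  have h2 := h1.trans (measureReal_union_le _ _)
  have h3 := measureReal_union_le (μ := P) {ω | ∀ k < N, ω k ∉ championSet R w s T}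
    ({ω | ∃ k < N, ω k ∈ overshootSet R w s M T} ∪
        {ω | (T : ℝ) ≤ ∑ k ∈ Finset.range N, cappedPulls R w s M T (ω k)})
  have h4 := measureReal_union_le (μ := P) {ω | ∃ k < N, ω k ∈ overshootSet R w s M T}
        {ω | (T : ℝ) ≤ ∑ k ∈ Finset.range N, cappedPulls R w s M T (ω k)}
  -- The three failures cost at most `3 δ / 4`, hence the strict inequality.
  linarith

/-! ### From the parameters to the rates -/

section Reduction

variable {R : Measure (ProbabilityMeasure ℝ)} [IsProbabilityMeasure R] {C : ℝ}

instance : IsProbabilityMeasure (banditLaw R) := by unfold banditLaw; infer_instance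

theorem regretAtMost_mono (R : Measure (ProbabilityMeasure ℝ)) (A β C δ : ℝ) (T : ℕ) {r r' : ℝ}
    (h : r ≤ r') : RegretAtMost R A β C δ T r ⊆ RegretAtMost R A β C δ T r' :=
  fun _ hω => ⟨hω.1, fun k hk => (hω.2 k hk).trans h⟩

theorem ae_banditLaw_gap_le (hbd : BoundedArms R C) :
    ∀ᵐ ω ∂(banditLaw R), ∀ k, gap R (ω k).1 ≤ 2 * C := by
  rw [ae_all_iff]
  intro k
  have h1 : ∀ᵐ a ∂(armLaw R), gap R a.1 ≤ 2 * C := by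
    have h2 : MeasurePreserving Prod.fst (armLaw R) R :=
      ⟨measurable_fst, by unfold armLaw; exact Measure.fst_compProd R sampleKernel⟩
    exact h2.quasiMeasurePreserving.ae (ae_gap_le hbd)
  exact (measurePreserving_eval_infinitePi (fun _ : ℕ => armLaw R) k).quasiMeasurePreserving.ae h1

theorem real_regretAtMost_eq_one (hbd : BoundedArms R C) {A β δ : ℝ} {T : ℕ}
    (hN : 0 < numArms A β T) {r : ℝ} (hr : 2 * C ≤ r) :
    (banditLaw R).real (RegretAtMost R A β C δ T r) = 1 := by
  have hae : ∀ᵐ ω ∂(banditLaw R), ω ∈ RegretAtMost R A β C δ T r := by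
    filter_upwards [ae_banditLaw_gap_le hbd] with ω hω
    exact ⟨exists_isOutput A β C δ T ω hN, fun k _ => (hω k).trans hr⟩
  exact (measureReal_congr (Filter.eventuallyEq_univ.2 hae)).trans (by simp)

/-- Regularity is available only up to scale `B`. For `s > B` the factor `1 + 2 * C / B` makes `r`
at least `2 * C`, which bounds every gap almost surely; for `δ > 1` the claim is void. -/
theorem lt_real_regretAtMost_of_imp (hbd : BoundedArms R C) {A β δ B s r : ℝ} {T : ℕ} (hC : 0 < C)
    (hB : 0 < B) (hδ : 0 < δ) (hN : 0 < numArms A β T) (hs : 0 < s) (hr : (1 + 2 * C / B) * s ≤ r)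
    (h : δ ≤ 1 → s ≤ B → 1 - δ < (banditLaw R).real (RegretAtMost R A β C δ T s)) :
    1 - δ < (banditLaw R).real (RegretAtMost R A β C δ T r) := by
  have hCB : 0 < 2 * C / B * s := by positivity
  rcases lt_or_ge 1 δ with hδ1 | hδ1
  · have := measureReal_nonneg (μ := banditLaw R) (s := RegretAtMost R A β C δ T r)
    linarith
  rcases le_or_gt s B with hsB | hsB
  · exact (h hδ1 hsB).trans_le (measureReal_mono (regretAtMost_mono R A β C δ T (by linarith)))
  · rw [real_regretAtMost_eq_one hbd hN]
    · linarith
    · have : 2 * C ≤ 2 * C / B * s := by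
        rw [div_mul_eq_mul_div, le_div_iff₀ hB]; gcongr
      linarith

end Reduction

/-! ### The number of arms -/

theorem pow_logArms_le {A β : ℝ} {T : ℕ} (hN : 0 < numArms A β T) :
    (2 : ℝ) ^ (logArms A β T : ℝ) ≤ numArms A β T := by
  have hN' : (1 : ℝ) ≤ numArms A β T := by exact_mod_cast hN
  rw [← Real.le_logb_iff_rpow_le (by norm_num) (by linarith)]
  exact Nat.floor_le (Real.logb_nonneg (by norm_num) hN')

theorem le_two_mul_pow_logArms {A β : ℝ} {T : ℕ} (hN : 0 < numArms A β T) :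
    (numArms A β T : ℝ) / 2 ≤ (2 : ℝ) ^ (logArms A β T : ℝ) := by
  have hN' : (1 : ℝ) ≤ numArms A β T := by exact_mod_cast hN
  have h1 : Real.logb 2 (numArms A β T) < (logArms A β T : ℝ) + 1 := Nat.lt_floor_add_one _
  rw [Real.logb_lt_iff_lt_rpow (by norm_num) (by linarith), Real.rpow_add (by norm_num),
    Real.rpow_one] at h1
  linarith

theorem two_rpow_logArms_eq {A β : ℝ} {T : ℕ} :
    (2 : ℝ) ^ (2 * (logArms A β T : ℝ) / min β 2) =
      ((2 : ℝ) ^ (logArms A β T : ℝ)) ^ (2 / min β 2) := by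
  rw [← Real.rpow_mul (by norm_num)]; congr 1; ring

/-- With `b = min β 2`, `D ≥ (N / 2) ^ (2 / b)` and `s ^ 2 ≥ (s ^ β) ^ (2 / b)`, so `D s ^ 2 ≥ (N s
^ β / 2) ^ (2 / b)`; base and exponent are both at least one. The factor 2 pays for rounding the
binary logarithm down. -/
theorem mul_rpow_le_two_mul {A β s : ℝ} {T : ℕ} (hβ : 0 < β) (hN : 0 < numArms A β T)
    (hs : 0 < s) (hs1 : s ≤ 1) (hQ : 2 ≤ numArms A β T * s ^ β) :
    numArms A β T * s ^ β ≤ 2 * ((2 : ℝ) ^ (2 * (logArms A β T : ℝ) / min β 2) * s ^ 2) := by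
  have hb : 0 < min β 2 := lt_min hβ (by norm_num)
  set b := min β 2 with hbdef
  have h2b : 1 ≤ 2 / b := by rw [one_le_div hb]; exact min_le_right _ _
  have hN' : (0 : ℝ) < numArms A β T := by exact_mod_cast hN
  have h1 : ((numArms A β T : ℝ) / 2) ^ (2 / b) ≤ ((2 : ℝ) ^ (logArms A β T : ℝ)) ^ (2 / b) :=
    Real.rpow_le_rpow (by positivity) (le_two_mul_pow_logArms hN) (by positivity)
  have h2 : (s ^ β) ^ (2 / b) ≤ s ^ 2 := by
    rw [← Real.rpow_mul hs.le, ← Real.rpow_two]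
    refine Real.rpow_le_rpow_of_exponent_ge hs hs1 ?_
    rw [← mul_div_assoc, le_div_iff₀ hb]
    linarith [min_le_left β 2]
  have h3 : numArms A β T * s ^ β / 2 ≤ (numArms A β T * s ^ β / 2) ^ (2 / b) :=
    Real.self_le_rpow_of_one_le (by linarith) h2b
  have h4 : (numArms A β T * s ^ β / 2) ^ (2 / b) =
      ((numArms A β T : ℝ) / 2) ^ (2 / b) * (s ^ β) ^ (2 / b) := by
    rw [← Real.mul_rpow (by positivity) (by positivity)]; congr 1; ring
  rw [two_rpow_logArms_eq, ← hbdef]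
  have h5 : ((numArms A β T : ℝ) / 2) ^ (2 / b) * (s ^ β) ^ (2 / b) ≤
      ((2 : ℝ) ^ (logArms A β T : ℝ)) ^ (2 / b) * s ^ 2 := by gcongr
  linarith

theorem one_le_tlog (x : ℝ) : 1 ≤ tlog x := le_max_left _ _

theorem log_four_div_le {δ : ℝ} (hδ : 0 < δ) : Real.log (4 / δ) ≤ 3 * tlog (1 / δ) := by
  have h1 : Real.log (4 / δ) = 2 * Real.log 2 + Real.log (1 / δ) := by
    rw [show (4 : ℝ) / δ = 2 ^ 2 * (1 / δ) by ring, Real.log_mul (by norm_num) (by positivity),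
      Real.log_pow]
    norm_num
  have h2 : Real.log (1 / δ) ≤ tlog (1 / δ) := le_max_right _ _
  linarith [Real.log_two_lt_d9, one_le_tlog (1 / δ)]

theorem posLog_le_tlog (x : ℝ) : Real.posLog x ≤ tlog x := by
  rw [Real.posLog_apply]; exact max_le_max zero_le_one le_rfl

theorem exists_dyadic_level (C : ℝ) {s : ℝ} (hs : 0 < s) :
    ∃ I : ℕ, 2 * C < 2 ^ (I + 1) * s ∧ 2 ^ I * s ≤ max (2 * C) s := by
  have hex : ∃ i : ℕ, 2 * C < 2 ^ (i + 1) * s := by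
    obtain ⟨n, hn⟩ := pow_unbounded_of_one_lt (2 * C / s) (one_lt_two (α := ℝ))
    refine ⟨n, ?_⟩
    rw [div_lt_iff₀ hs] at hn
    have : (0 : ℝ) < 2 ^ n * s := by positivity
    rw [pow_succ]; linarith
  classical
  refine ⟨Nat.find hex, Nat.find_spec hex, ?_⟩
  rcases h : Nat.find hex with _ | i
  · simp
  · exact le_max_of_le_left (not_lt.1 (Nat.find_min hex (m := i) (by omega)))

/-! ### The case `β < 2` -/

theorem exists_sum_level_le_of_lt_two {β : ℝ} (hβ : β < 2) :
    ∃ G : ℝ, 0 < G ∧ ∀ (s Λ : ℝ) (I : ℕ), 0 < s → 1 ≤ Λ →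
      ∑ i ∈ Finset.range (I + 1), (2 ^ i * s) ^ (β - 2) * (Λ + i) ≤ G * (s ^ (β - 2) * Λ) := by
  set ρ : ℝ := 2 ^ (β - 2) with hρ
  have hρ0 : 0 < ρ := by positivity
  have hρ1 : ρ < 1 := Real.rpow_lt_one_of_one_lt_of_neg (by norm_num) (by linarith)
  have hsum : Summable fun i : ℕ => ρ ^ i * (1 + i) := by
    have h1 := summable_geometric_of_lt_one hρ0.le hρ1
    have h2 := summable_pow_mul_geometric_of_norm_lt_one 1
      (r := ρ) (by rw [Real.norm_of_nonneg hρ0.le]; exact hρ1)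
    refine (h1.add h2).congr fun i => ?_
    rw [pow_one]; ring
  have hpos : ∀ i : ℕ, 0 ≤ ρ ^ i * (1 + i) := fun i => by positivity
  refine ⟨∑' i : ℕ, ρ ^ i * (1 + i) + 1, by
    have : 0 ≤ ∑' i : ℕ, ρ ^ i * (1 + i) := tsum_nonneg hpos
    linarith, fun s Λ I hs hΛ => ?_⟩
  calc _ ≤ ∑ i ∈ Finset.range (I + 1), ρ ^ i * (1 + i) * (s ^ (β - 2) * Λ) := by
        refine Finset.sum_le_sum fun i _ => ?_
        have h1 : ((2 : ℝ) ^ i * s) ^ (β - 2) = ρ ^ i * s ^ (β - 2) := by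
          rw [Real.mul_rpow (by positivity) hs.le, hρ, ← Real.rpow_natCast, ← Real.rpow_natCast,
            ← Real.rpow_mul (by norm_num), ← Real.rpow_mul (by norm_num), mul_comm (i : ℝ)]
        have h2 : Λ + i ≤ Λ * (1 + i) := by nlinarith [Nat.cast_nonneg (α := ℝ) i]
        rw [h1]
        calc _ ≤ ρ ^ i * s ^ (β - 2) * (Λ * (1 + i)) := by gcongr
          _ = _ := by ring
    _ ≤ _ := by
        rw [← Finset.sum_mul]
        gcongr
        linarith [hsum.sum_le_tsum (Finset.range (I + 1)) fun i _ => hpos i]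

/-- Scaling `s` by `E` multiplies the main term of the pull count by `E ^ (β - 2)` and adds only a
multiple of `log E` to `Λ`, so a large `E` wins. -/
theorem exists_scale_of_lt_two {β : ℝ} (hβ : 0 < β) (hβ2 : β < 2) (a b c : ℝ) :
    ∃ E : ℝ, 1 ≤ E ∧ a ≤ E ^ β ∧ b * (c + 2 * Real.log E) ≤ E ^ (2 - β) := by
  have h1 : Filter.Tendsto (fun x : ℝ => x ^ β) Filter.atTop Filter.atTop :=
    tendsto_rpow_atTop hβ
  have h2 : Filter.Tendsto (fun x : ℝ => x ^ (2 - β)) Filter.atTop Filter.atTop :=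
    tendsto_rpow_atTop (by linarith)
  have h3 : (fun x : ℝ => b * (c + 2 * Real.log x)) =o[Filter.atTop] fun x => x ^ (2 - β) := by
    refine Asymptotics.IsLittleO.const_mul_left (Asymptotics.IsLittleO.add ?_ ?_) b
    · exact Asymptotics.isLittleO_const_left.2
        (Or.inr (tendsto_norm_atTop_atTop.comp h2))
    · exact (isLittleO_log_rpow_atTop (by linarith)).const_mul_left 2
  obtain ⟨E, hE1, hE2, hE3⟩ := ((Filter.eventually_ge_atTop (1 : ℝ)).and
    ((h1.eventually_ge_atTop a).and (h3.bound one_pos))).exists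
  refine ⟨E, hE1, hE2, (le_abs_self _).trans ?_⟩
  rw [one_mul, Real.norm_eq_abs, Real.norm_of_nonneg (by positivity)] at hE3
  exact hE3

theorem exists_regret_le_of_lt_two {β E₁ E₂ B C : ℝ} (hβ : 0 < β) (hβ2 : β < 2) (hE₁ : 0 < E₁)
    (hE₂ : 0 < E₂) (hB : 0 < B) (hB1 : B < 1) (hC : 0 < C) :
    ∃ E : ℝ, 0 < E ∧ ∀ δ : ℝ, 0 < δ →
      ∀ (R : Measure (ProbabilityMeasure ℝ)) [IsProbabilityMeasure R],
        BoundedArms R C → BetaRegular R β E₁ E₂ B → ∀ T : ℕ, 1 ≤ T →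
          1 - δ < (banditLaw R).real (RegretAtMost R (tlog (1 / δ) ^ (1 - β)) β C δ T
            (E * (T : ℝ) ^ (-(1 / 2) : ℝ) * tlog (1 / δ))) := by
  obtain ⟨K₁, K₂, hK₁, hK₂, hcore⟩ := exists_lt_real_regretAtMost hβ hE₁ hE₂ hB hB1 hC
  obtain ⟨G, hG, hsum⟩ := exists_sum_level_le_of_lt_two hβ2
  obtain ⟨E₀, hE₀1, hE₀K, hE₀⟩ := exists_scale_of_lt_two hβ hβ2 (3 * K₁ + 2)
    (2 * K₂ * G) (2 + 4 / β)
  have hE₀0 : 0 < E₀ := by linarith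
  refine ⟨(1 + 2 * C / B) * E₀, by positivity, fun δ hδ R _ hbd hR T hT => ?_⟩
  have hT0 : (0 : ℝ) < T := by exact_mod_cast hT
  set ℒ := tlog (1 / δ) with hℒ
  have hℒ1 : 1 ≤ ℒ := one_le_tlog _
  have hℒ0 : 0 < ℒ := by linarith
  -- Since `s` is proportional to `ℒ * T ^ (-1/2)`, this choice makes `N * s ^ β` of order `ℒ`, just
  -- what a champion requires.
  set A := ℒ ^ (1 - β) with hA
  have hA0 : 0 < A := by positivity
  have hNdef : numArms A β T = ⌈A * (T : ℝ) ^ (β / 2)⌉₊ := by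
    simp only [numArms, armFactor, hβ2, if_true, min_eq_left hβ2.le]
  have hN0 : 0 < numArms A β T := by rw [hNdef, Nat.ceil_pos]; positivity
  have hNlow : A * (T : ℝ) ^ (β / 2) ≤ numArms A β T := by rw [hNdef]; exact Nat.le_ceil _
  have hNup : (numArms A β T : ℝ) ≤ A * (T : ℝ) ^ (β / 2) + 1 := by
    rw [hNdef]; exact (Nat.ceil_lt_add_one (by positivity)).le
  set N := numArms A β T with hN
  set s := E₀ * ℒ * (T : ℝ) ^ (-(1 / 2) : ℝ) with hs
  have hs0 : 0 < s := by positivity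
  refine lt_real_regretAtMost_of_imp hbd hC hB hδ hN0 hs0 (by rw [hs]; apply le_of_eq; ring) ?_
  intro hδ1 hsB
  have hs1 : s ≤ 1 := by linarith
  have hAs : A * (T : ℝ) ^ (β / 2) * s ^ β = E₀ ^ β * ℒ := by
    have h1 : ((T : ℝ) ^ (-(1 / 2) : ℝ)) ^ β = ((T : ℝ) ^ (β / 2))⁻¹ := by
      rw [← Real.rpow_mul hT0.le, ← Real.rpow_neg hT0.le]; congr 1; ring
    have h2 : A * ℒ ^ β = ℒ := by
      rw [hA, ← Real.rpow_add hℒ0]; simp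
    rw [hs, Real.mul_rpow (by positivity) (by positivity), Real.mul_rpow hE₀0.le hℒ0.le, h1]
    calc _ = E₀ ^ β * (A * ℒ ^ β) * ((T : ℝ) ^ (β / 2) * ((T : ℝ) ^ (β / 2))⁻¹) := by ring
      _ = _ := by rw [h2, mul_inv_cancel₀ (by positivity), mul_one]
  have hEβ : 2 ≤ E₀ ^ β := by linarith
  have hQlow : E₀ ^ β * ℒ ≤ N * s ^ β := by rw [← hAs]; gcongr
  have hQup : N * s ^ β ≤ 2 * (E₀ ^ β * ℒ) := by
    have h1 : s ^ β ≤ 1 := Real.rpow_le_one hs0.le hs1 hβ.le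
    have h2 : N * s ^ β ≤ (A * (T : ℝ) ^ (β / 2) + 1) * s ^ β := by gcongr
    nlinarith
  obtain ⟨I, hI, -⟩ := exists_dyadic_level C hs0
  set D := (2 : ℝ) ^ (2 * (logArms A β T : ℝ) / min β 2) with hD
  have hD0 : 0 < D := by positivity
  refine hcore R hbd hR A δ s D T I N rfl rfl hδ hδ1 hs0 hsB ?_ ?_ hI ?_
  · refine le_trans ?_ hQlow
    calc K₁ * Real.log (4 / δ) ≤ K₁ * (3 * ℒ) := by gcongr; exact log_four_div_le hδ
      _ = 3 * K₁ * ℒ := by ring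
      _ ≤ _ := by gcongr; linarith
  · exact mul_rpow_le_two_mul hβ hN0 hs0 hs1 (by nlinarith)
  set Λ := 1 + Real.posLog (D * s ^ 2 / δ) with hΛ
  have hΛ1 : 1 ≤ Λ := by rw [hΛ]; linarith [Real.posLog_nonneg (x := D * s ^ 2 / δ)]
  have hDs : D * s ^ 2 ≤ (2 * (E₀ ^ β * ℒ)) ^ (2 / β) := by
    have h1 : D ≤ (N : ℝ) ^ (2 / β) := by
      rw [hD, two_rpow_logArms_eq, min_eq_left hβ2.le]
      exact Real.rpow_le_rpow (by positivity) (pow_logArms_le hN0) (by positivity)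
    have h2 : s ^ 2 = (s ^ β) ^ (2 / β) := by
      rw [← Real.rpow_mul hs0.le, ← Real.rpow_two]; congr 1; field_simp
    calc D * s ^ 2 ≤ (N : ℝ) ^ (2 / β) * (s ^ β) ^ (2 / β) := by rw [h2]; gcongr
      _ = (N * s ^ β) ^ (2 / β) := (Real.mul_rpow (by positivity) (by positivity)).symm
      _ ≤ _ := by gcongr
  have hlogE : 0 ≤ Real.log E₀ := Real.log_nonneg hE₀1
  have hlogDs : Real.posLog (D * s ^ 2) ≤ 2 / β * (1 + β * Real.log E₀ + ℒ) := by
    refine (Real.posLog_le_posLog (by positivity) hDs).trans ?_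
    rw [Real.posLog_apply]
    refine max_le (by positivity) ?_
    rw [Real.log_rpow (by positivity), Real.log_mul (by norm_num) (by positivity),
      Real.log_mul (by positivity) (by positivity), Real.log_rpow hE₀0]
    have h1 : Real.log 2 + (β * Real.log E₀ + Real.log ℒ) ≤ 1 + β * Real.log E₀ + ℒ := by
      linarith [Real.log_two_lt_d9, Real.log_le_self hℒ0.le]
    gcongr
  have hΛup : Λ ≤ (2 + 4 / β + 2 * Real.log E₀) * ℒ := by
    have h1 : Real.posLog (D * s ^ 2 / δ) ≤ Real.posLog (D * s ^ 2) + ℒ := by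
      rw [div_eq_mul_one_div]
      exact Real.posLog_mul.trans (by gcongr; exact posLog_le_tlog _)
    have h2 : 2 / β * (1 + β * Real.log E₀ + ℒ) = 2 / β + 2 * Real.log E₀ + 2 / β * ℒ := by
      field_simp
    have h3 : 2 / β ≤ 2 / β * ℒ := le_mul_of_one_le_right (by positivity) hℒ1
    have h4 : 2 * Real.log E₀ ≤ 2 * Real.log E₀ * ℒ := le_mul_of_one_le_right (by positivity) hℒ1
    calc Λ ≤ ℒ + ((2 / β * ℒ + 2 * Real.log E₀ * ℒ + 2 / β * ℒ) + ℒ) := by rw [hΛ]; linarith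
      _ = _ := by ring
  have hs2 : s ^ (β - 2) = s ^ β * (T / (E₀ ^ 2 * ℒ ^ 2)) := by
    have h1 : ((T : ℝ) ^ (-(1 / 2) : ℝ)) ^ 2 = (T : ℝ)⁻¹ := by
      rw [← Real.rpow_two, ← Real.rpow_mul hT0.le, ← Real.rpow_neg_one]; norm_num
    have h2 : s ^ 2 = E₀ ^ 2 * ℒ ^ 2 / T := by rw [hs, mul_pow, mul_pow, h1]; ring
    rw [Real.rpow_sub hs0, Real.rpow_two, h2]; field_simp
  have hE₀2 : E₀ ^ 2 = E₀ ^ β * E₀ ^ (2 - β) := by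
    rw [← Real.rpow_add hE₀0, ← Real.rpow_two]; congr 1; ring
  -- The powers of `ℒ` cancel: one from `N s ^ β`, one from `Λ`, and `ℒ ^ (-2)` from `s ^ (-2)`.
  calc _ ≤ K₂ * (N * (G * (s ^ (β - 2) * Λ))) := by gcongr; exact hsum s Λ I hs0 hΛ1
    _ = K₂ * G * (N * s ^ β) * (T / (E₀ ^ 2 * ℒ ^ 2)) * Λ := by rw [hs2]; ring
    _ ≤ K₂ * G * (2 * (E₀ ^ β * ℒ)) * (T / (E₀ ^ 2 * ℒ ^ 2)) *
        ((2 + 4 / β + 2 * Real.log E₀) * ℒ) := by gcongr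
    _ = T * (E₀ ^ β / E₀ ^ 2) * (2 * K₂ * G * (2 + 4 / β + 2 * Real.log E₀)) := by
        field_simp
    _ ≤ T * (E₀ ^ β / E₀ ^ 2) * E₀ ^ (2 - β) := by gcongr
    _ = T := by rw [hE₀2]; field_simp

/-! ### The case `2 ≤ β` -/

/-- The ratio `2 ^ (β - 2)` exceeds one, so the top level, at scale at most `W`, dominates and `s`
disappears from the bound. -/
theorem exists_sum_level_le_of_two_lt {β W : ℝ} (hβ : 2 < β) (hW : 0 < W) :
    ∃ G : ℝ, 0 < G ∧ ∀ (s Λ : ℝ) (I : ℕ), 0 < s → 0 ≤ Λ → 2 ^ I * s ≤ W →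
      ∑ i ∈ Finset.range (I + 1), (2 ^ i * s) ^ (β - 2) * (Λ + i) ≤ G * (Λ + I) := by
  set q : ℝ := 2 ^ (β - 2) with hq
  have hq1 : 1 < q := Real.one_lt_rpow (by norm_num) (by linarith)
  have hq0 : 0 < q - 1 := by linarith
  refine ⟨W ^ (β - 2) * (q / (q - 1)), by positivity, fun s Λ I hs hΛ hI => ?_⟩
  have hpow : ∀ i : ℕ, ((2 : ℝ) ^ i * s) ^ (β - 2) = q ^ i * s ^ (β - 2) := fun i => by
    rw [Real.mul_rpow (by positivity) hs.le, hq, ← Real.rpow_natCast, ← Real.rpow_natCast,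
      ← Real.rpow_mul (by norm_num), ← Real.rpow_mul (by norm_num), mul_comm (i : ℝ)]
  have hW' : q ^ I * s ^ (β - 2) ≤ W ^ (β - 2) := by
    rw [← hpow]
    exact Real.rpow_le_rpow (by positivity) hI (by linarith)
  calc _ ≤ ∑ i ∈ Finset.range (I + 1), q ^ i * (s ^ (β - 2) * (Λ + I)) := by
        refine Finset.sum_le_sum fun i hi => ?_
        have hiI : (i : ℝ) ≤ I := by exact_mod_cast Nat.lt_succ_iff.1 (Finset.mem_range.1 hi)
        rw [hpow, mul_assoc]
        gcongr
    _ = (q ^ (I + 1) - 1) / (q - 1) * (s ^ (β - 2) * (Λ + I)) := by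
        rw [← Finset.sum_mul, geom_sum_eq (by linarith)]
    _ ≤ q ^ (I + 1) / (q - 1) * (s ^ (β - 2) * (Λ + I)) := by gcongr; linarith
    _ = q ^ I * s ^ (β - 2) * (q / (q - 1)) * (Λ + I) := by rw [pow_succ]; ring
    _ ≤ _ := by gcongr

theorem nat_le_of_two_pow_mul_le {W s T : ℝ} (hW : 1 ≤ W) {I : ℕ} (hT : 1 ≤ Real.log T)
    (hT0 : 0 < T) (hs : T ^ (-(1 / 2) : ℝ) ≤ s) (hI : 2 ^ I * s ≤ W) :
    (I : ℝ) ≤ (2 * Real.log W + 1) * Real.log T := by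
  have hW0 : 0 ≤ Real.log W := Real.log_nonneg hW
  have h1 : (2 : ℝ) ^ I * T ^ (-(1 / 2) : ℝ) ≤ W := le_trans (by gcongr) hI
  have h2 := Real.log_le_log (by positivity) h1
  rw [Real.log_mul (by positivity) (by positivity), Real.log_pow, Real.log_rpow hT0] at h2
  have h3 : (I : ℝ) * (1 / 2) ≤ I * Real.log 2 := by
    gcongr; linarith [Real.log_two_gt_d9]
  nlinarith

set_option maxHeartbeats 800000 in
/-- The regret bound for `2 ≤ β`, with `numArms = ⌈a / (tlog (1 / δ) (log T)^(p + 1)) T⌉`. -/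
theorem exists_regret_le_of_two_le {β E₁ E₂ B C : ℝ} (hβ2 : 2 ≤ β) (hE₁ : 0 < E₁)
    (hE₂ : 0 < E₂) (hB : 0 < B) (hB1 : B < 1) (hC : 0 < C) {p : ℕ} {G : ℝ} (hG : 0 < G)
    (hsum : ∀ (s Λ U : ℝ) (I : ℕ), 0 < s → 0 ≤ Λ → 1 ≤ U → 2 ^ I * s ≤ 2 * C + 1 →
      (I : ℝ) ≤ (2 * Real.log (2 * C + 1) + 1) * U →
      ∑ i ∈ Finset.range (I + 1), (2 ^ i * s) ^ (β - 2) * (Λ + i) ≤ G * U ^ p * (Λ + I)) :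
    ∃ a E₀ : ℝ, 0 < a ∧ 0 < E₀ ∧ ∀ δ : ℝ, 0 < δ →
      ∀ (R : Measure (ProbabilityMeasure ℝ)) [IsProbabilityMeasure R],
        BoundedArms R C → BetaRegular R β E₁ E₂ B → ∀ T : ℕ, 3 ≤ T → ∀ s r : ℝ, 0 < s →
          numArms (a / tlog (1 / δ)) β T = ⌈a / tlog (1 / δ) / Real.log T ^ (p + 1) * T⌉₊ →
          s ^ β = E₀ ^ β * (Real.log T ^ (p + 1) / T) * tlog (Real.log T / δ) ^ β →
          (1 + 2 * C / B) * s ≤ r →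
          1 - δ < (banditLaw R).real (RegretAtMost R (a / tlog (1 / δ)) β C δ T r) := by
  have hβ : 0 < β := by linarith
  obtain ⟨K₁, K₂, hK₁, hK₂, hcore⟩ := exists_lt_real_regretAtMost hβ hE₁ hE₂ hB hB1 hC
  set κ : ℝ := 2 * Real.log (2 * C + 1) + 1 with hκ
  have hκ1 : 1 ≤ κ := by
    rw [hκ]; linarith [Real.log_nonneg (show 1 ≤ 2 * C + 1 by linarith)]
  -- Small enough for the total pull count, with `N ≤ 2 x` and `Λ + I ≤ (3 + κ) U ℒ`, to stay below
  -- `T`.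
  set a : ℝ := 1 / (1 + 2 * K₂ * G * (3 + κ)) with ha
  have ha0 : 0 < a := by positivity
  have ha1 : a ≤ 1 := by
    rw [ha, div_le_one (by positivity)]; linarith [show 0 < 2 * K₂ * G * (3 + κ) by positivity]
  have haK : 2 * a * (K₂ * G * (3 + κ)) ≤ 1 := by
    have h1 : 2 * a * (K₂ * G * (3 + κ)) =
        (2 * K₂ * G * (3 + κ)) / (1 + 2 * K₂ * G * (3 + κ)) := by rw [ha]; ring
    rw [h1, div_le_one (by positivity)]; linarith
  -- This is `E₀ ^ β`: dividing by `a` undoes the small number of arms, so that `N * s ^ β ≥ (3 * K₁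
  -- + 2) * ℒ`.
  set e : ℝ := (3 * K₁ + 2) / a with he
  have he0 : 0 < e := by positivity
  have hE₀ : (e ^ (1 / β)) ^ β = e := by
    rw [← Real.rpow_mul he0.le, one_div_mul_cancel hβ.ne', Real.rpow_one]
  refine ⟨a, e ^ (1 / β), ha0, by positivity, fun δ hδ R _ hbd hR T hT s r hs0 hNdef hsβ hr => ?_⟩
  rw [hE₀] at hsβ
  have hT3 : (3 : ℝ) ≤ T := by exact_mod_cast hT
  have hT0 : (0 : ℝ) < T := by linarith
  set U := Real.log T with hU
  have hU1 : 1 ≤ U := by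
    rw [hU, Real.le_log_iff_exp_le hT0]; linarith [Real.exp_one_lt_d9]
  have hU0 : 0 < U := by linarith
  set ℒ := tlog (1 / δ) with hℒ
  have hℒ1 : 1 ≤ ℒ := one_le_tlog _
  have hℒ0 : 0 < ℒ := by linarith
  set ℒ' := tlog (U / δ) with hℒ'
  have hℒℒ' : ℒ ≤ ℒ' := by
    refine max_le_max le_rfl (Real.log_le_log (by positivity) ?_)
    gcongr
  set A := a / ℒ with hA
  have hA0 : 0 < A := by positivity
  set x : ℝ := A / U ^ (p + 1) * T with hx
  have hx0 : 0 < x := by positivity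
  have hN0 : 0 < numArms A β T := by rw [hNdef, Nat.ceil_pos]; positivity
  have hNlow : x ≤ numArms A β T := by rw [hNdef]; exact Nat.le_ceil _
  have hNup : (numArms A β T : ℝ) ≤ x + 1 := by
    rw [hNdef]; exact (Nat.ceil_lt_add_one (by positivity)).le
  have hNT : (numArms A β T : ℝ) ≤ T := by
    rw [hNdef]
    have h1 : x ≤ T := by
      have h2 : A / U ^ (p + 1) ≤ 1 := by
        rw [div_le_one (by positivity), hA]
        exact (div_le_one_of_le₀ (by linarith) hℒ0.le).trans (one_le_pow₀ hU1)
      rw [hx]; nlinarith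
    exact_mod_cast Nat.ceil_le.2 h1
  set N := numArms A β T with hN
  refine lt_real_regretAtMost_of_imp hbd hC hB hδ hN0 hs0 hr ?_
  intro hδ1 hsB
  have hs1 : s ≤ 1 := by linarith
  -- One factor `ℒ` offsets the `1 / ℒ` in `A`, the other is the one needed for a champion; `β ≥ 2`
  -- supplies both.
  have hℒβ : ℒ ^ 2 ≤ ℒ' ^ β := by
    calc ℒ ^ 2 ≤ ℒ' ^ 2 := by gcongr
      _ = ℒ' ^ (2 : ℝ) := (Real.rpow_two _).symm
      _ ≤ ℒ' ^ β := Real.rpow_le_rpow_of_exponent_le (by linarith) hβ2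
  have hxs : (3 * K₁ + 2) * ℒ ≤ x * s ^ β := by
    have h1 : x * s ^ β = (3 * K₁ + 2) / ℒ * ℒ' ^ β := by
      rw [hsβ, hx, hA, he]; field_simp
    calc (3 * K₁ + 2) * ℒ = (3 * K₁ + 2) / ℒ * ℒ ^ 2 := by field_simp
      _ ≤ _ := by rw [h1]; gcongr
  have hQ : (3 * K₁ + 2) * ℒ ≤ N * s ^ β := hxs.trans (by gcongr)
  have hx1 : 1 ≤ x := by
    have h1 : s ^ β ≤ 1 := Real.rpow_le_one hs0.le hs1 hβ.le
    have h2 : x * s ^ β ≤ x * 1 := by gcongr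
    nlinarith
  have hsT : (T : ℝ) ^ (-(1 / 2) : ℝ) ≤ s := by
    have h1 : (1 : ℝ) / T ≤ s ^ β := by
      have h2 : 1 ≤ e := by
        rw [he, one_le_div ha0]; linarith
      have h3 : 1 ≤ ℒ' ^ β := (one_le_pow₀ hℒ1).trans hℒβ
      have h4 : 1 ≤ U ^ (p + 1) := one_le_pow₀ hU1
      rw [hsβ]
      calc (1 : ℝ) / T = 1 * (1 / T) * 1 := by ring
        _ ≤ _ := by gcongr
    have h5 : ((1 : ℝ) / T) ^ (1 / β) ≤ (s ^ β) ^ (1 / β) :=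
      Real.rpow_le_rpow (by positivity) h1 (by positivity)
    rw [← Real.rpow_mul hs0.le, mul_one_div_cancel hβ.ne', Real.rpow_one] at h5
    refine le_trans ?_ h5
    rw [one_div (T : ℝ), Real.inv_rpow hT0.le, ← Real.rpow_neg hT0.le]
    refine Real.rpow_le_rpow_of_exponent_le (by linarith) (neg_le_neg ?_)
    exact one_div_le_one_div_of_le (by norm_num) hβ2
  obtain ⟨I, hI, hIW⟩ := exists_dyadic_level C hs0
  have hIW' : 2 ^ I * s ≤ 2 * C + 1 := hIW.trans (max_le (by linarith) (by linarith))
  have hIU : (I : ℝ) ≤ κ * U := nat_le_of_two_pow_mul_le (by linarith) hU1 hT0 hsT hIW'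
  set D := (2 : ℝ) ^ (2 * (logArms A β T : ℝ) / min β 2) with hD
  have hD0 : 0 < D := by positivity
  refine hcore R hbd hR A δ s D T I N rfl rfl hδ hδ1 hs0 hsB ?_ ?_ hI ?_
  · refine le_trans ?_ hQ
    calc K₁ * Real.log (4 / δ) ≤ K₁ * (3 * ℒ) := by gcongr; exact log_four_div_le hδ
      _ ≤ _ := by nlinarith
  · exact mul_rpow_le_two_mul hβ hN0 hs0 hs1 (by nlinarith)
  set Λ := 1 + Real.posLog (D * s ^ 2 / δ) with hΛ
  have hΛ1 : 1 ≤ Λ := by rw [hΛ]; linarith [Real.posLog_nonneg (x := D * s ^ 2 / δ)]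
  have hΛup : Λ + I ≤ (3 + κ) * (U * ℒ) := by
    have h1 : D ≤ T := by
      rw [hD, two_rpow_logArms_eq, min_eq_right hβ2, div_self two_ne_zero, Real.rpow_one]
      exact (pow_logArms_le hN0).trans hNT
    have h2 : D * s ^ 2 / δ ≤ T * (1 / δ) := by
      rw [div_eq_mul_one_div]
      gcongr
      calc D * s ^ 2 ≤ D * 1 := by gcongr; exact pow_le_one₀ hs0.le hs1
        _ ≤ T := by rw [mul_one]; exact h1
    have h3 : Real.posLog (D * s ^ 2 / δ) ≤ U + ℒ := by
      refine (Real.posLog_le_posLog (by positivity) h2).trans (Real.posLog_mul.trans ?_)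
      rw [Real.log_of_nat_eq_posLog]
      gcongr
      exact posLog_le_tlog _
    have h4 : U ≤ U * ℒ := le_mul_of_one_le_right hU0.le hℒ1
    have h5 : ℒ ≤ U * ℒ := le_mul_of_one_le_left hℒ0.le hU1
    have h6 : κ * U ≤ κ * (U * ℒ) := by gcongr
    linarith
  have hN2 : (N : ℝ) ≤ 2 * x := by linarith
  calc _ ≤ K₂ * (2 * x * (G * U ^ p * ((3 + κ) * (U * ℒ)))) := by
        have h1 := hsum s Λ U I hs0 (by linarith) hU1 hIW' hIU
        have h2 : ∑ i ∈ Finset.range (I + 1), (2 ^ i * s) ^ (β - 2) * (Λ + i) ≤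
          G * U ^ p * ((3 + κ) * (U * ℒ)) := h1.trans (by gcongr)
        gcongr
    _ = 2 * a * (K₂ * G * (3 + κ)) * T := by
        rw [hx, hA, pow_succ]; field_simp
    _ ≤ 1 * T := by gcongr
    _ = T := one_mul _

/-! ### Assembly of the three regimes of `β` -/

theorem one_le_tlog_pow (x : ℝ) (n : ℕ) : 1 ≤ tlog x ^ n := one_le_pow₀ (one_le_tlog x)

end InfiniteArms

theorem mainTheorem9 (β E₁ E₂ B C : ℝ) (hβ : 0 < β) (hE₁ : 0 < E₁) (hE₂ : 0 < E₂)
    (hB : 0 < B) (hB1 : B < 1) (hC : 0 < C) :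
    ∃ (E : ℝ) (T₀ : ℕ), 0 < E ∧
      ∀ δ : ℝ, 0 < δ → ∃ A : ℝ, 0 < A ∧
        ∀ (R : Measure (ProbabilityMeasure ℝ)) [IsProbabilityMeasure R],
          InfiniteArms.BoundedArms R C → InfiniteArms.BetaRegular R β E₁ E₂ B →
          ∀ T : ℕ, T₀ ≤ T →
            (β < 2 →
              1 - δ < (InfiniteArms.banditLaw R).real (InfiniteArms.RegretAtMost R A β C δ T
                (E * (T : ℝ) ^ (-(1 / 2) : ℝ) * InfiniteArms.tlog (1 / δ)
                  * InfiniteArms.tlog (InfiniteArms.tlog (1 / δ)) ^ 96))) ∧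
            (2 < β →
              1 - δ < (InfiniteArms.banditLaw R).real (InfiniteArms.RegretAtMost R A β C δ T
                (E * ((T : ℝ) / Real.log T) ^ (-(1 / β))
                  * InfiniteArms.tlog (InfiniteArms.tlog (Real.log T / δ)) ^ 96
                  * InfiniteArms.tlog (Real.log T / δ)))) ∧
            (β = 2 →
              1 - δ < (InfiniteArms.banditLaw R).real (InfiniteArms.RegretAtMost R A β C δ T
                (E * Real.log T * (T : ℝ) ^ (-(1 / 2) : ℝ)
                  * InfiniteArms.tlog (InfiniteArms.tlog (Real.log T / δ)) ^ 96
                  * InfiniteArms.tlog (Real.log T / δ)))) := by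
  have hlog : ∀ T : ℕ, 3 ≤ T → 0 < Real.log T := fun T hT =>
    Real.log_pos (by exact_mod_cast (show 1 < T by omega))
  have htl : ∀ x, 0 < InfiniteArms.tlog x := fun x => one_pos.trans_le (InfiniteArms.one_le_tlog x)
  rcases lt_trichotomy β 2 with h | h | h
  · obtain ⟨E, hE, hmain⟩ := InfiniteArms.exists_regret_le_of_lt_two hβ h hE₁ hE₂ hB hB1 hC
    refine ⟨E, 1, hE, fun δ hδ => ⟨_, Real.rpow_pos_of_pos (htl (1 / δ)) (1 - β),
      fun R _ hbd hR T hT => ⟨fun _ => ?_, fun h' => absurd h' (by linarith),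
        fun h' => absurd h' h.ne⟩⟩⟩
    refine (hmain δ hδ R hbd hR T hT).trans_le
      (measureReal_mono (InfiniteArms.regretAtMost_mono _ _ _ _ _ _ ?_))
    have := htl (1 / δ)
    exact le_mul_of_one_le_right (by positivity) (InfiniteArms.one_le_tlog_pow _ _)
  · have hκ : 0 ≤ 2 * Real.log (2 * C + 1) := by
      have := Real.log_nonneg (show 1 ≤ 2 * C + 1 by linarith); positivity
    -- At `β = 2` every level has weight one, and the `I + 1 = O(log T)` levels cost one extra
    -- logarithm, recorded by `p = 1`; for `β > 2` there is none.
    obtain ⟨a, E₀, ha, hE₀, hmain⟩ := InfiniteArms.exists_regret_le_of_two_le (p := 1) h.ge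
      hE₁ hE₂ hB hB1 hC (show 0 < 2 * Real.log (2 * C + 1) + 2 by positivity) (by
        intro s Λ U I hs hΛ hU _ hI
        calc _ ≤ ∑ i ∈ Finset.range (I + 1), (Λ + I) := by
              refine Finset.sum_le_sum fun i hi => ?_
              have hiI : (i : ℝ) ≤ I := by
                exact_mod_cast Nat.lt_succ_iff.1 (Finset.mem_range.1 hi)
              rw [h, sub_self, Real.rpow_zero, one_mul]
              linarith
          _ = (I + 1) * (Λ + I) := by simp; ring
          _ ≤ _ := by
              gcongr
              rw [pow_one]; nlinarith)
    refine ⟨(1 + 2 * C / B) * E₀, 3, by positivity, fun δ hδ => ⟨_, div_pos ha (htl (1 / δ)),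
      fun R _ hbd hR T hT => ⟨fun h' => absurd h h'.ne, fun h' => absurd h h'.ne', fun _ => ?_⟩⟩⟩
    have hU := hlog T hT
    have hT0 : (0 : ℝ) < T := by exact_mod_cast (show 0 < T by omega)
    have hL := htl (Real.log T / δ)
    refine hmain δ hδ R hbd hR T hT
      (E₀ * Real.log T * (T : ℝ) ^ (-(1 / 2) : ℝ) * InfiniteArms.tlog (Real.log T / δ)) _
      (by positivity) ?_ ?_ ?_
    · simp [InfiniteArms.numArms, InfiniteArms.armFactor, h]
    · have h1 : ((T : ℝ) ^ (-(1 / 2) : ℝ)) ^ 2 = (T : ℝ)⁻¹ := by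
        rw [← Real.rpow_two, ← Real.rpow_mul hT0.le, ← Real.rpow_neg_one]; norm_num
      rw [h]; simp only [Real.rpow_two]
      rw [mul_pow, mul_pow, mul_pow, h1]; ring
    · calc _ = (1 + 2 * C / B) * E₀ * Real.log T * (T : ℝ) ^ (-(1 / 2) : ℝ) * 1 *
            InfiniteArms.tlog (Real.log T / δ) := by ring
        _ ≤ _ := by gcongr; exact InfiniteArms.one_le_tlog_pow _ _
  · obtain ⟨G, hG, hsum⟩ := InfiniteArms.exists_sum_level_le_of_two_lt h
      (show 0 < 2 * C + 1 by positivity)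
    obtain ⟨a, E₀, ha, hE₀, hmain⟩ := InfiniteArms.exists_regret_le_of_two_le (p := 0) h.le
      hE₁ hE₂ hB hB1 hC hG (by
        intro s Λ U I hs hΛ _ hI _
        rw [pow_zero, mul_one]
        exact hsum s Λ I hs hΛ hI)
    refine ⟨(1 + 2 * C / B) * E₀, 3, by positivity, fun δ hδ => ⟨_, div_pos ha (htl (1 / δ)),
      fun R _ hbd hR T hT => ⟨fun h' => absurd h' (by linarith), fun _ => ?_,
        fun h' => absurd h' h.ne'⟩⟩⟩
    have hU := hlog T hT
    have hT0 : (0 : ℝ) < T := by exact_mod_cast (show 0 < T by omega)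
    have hL := htl (Real.log T / δ)
    refine hmain δ hδ R hbd hR T hT
      (E₀ * ((T : ℝ) / Real.log T) ^ (-(1 / β)) * InfiniteArms.tlog (Real.log T / δ)) _
      (by positivity) ?_ ?_ ?_
    · simp [InfiniteArms.numArms, InfiniteArms.armFactor, h.not_gt, h.ne', min_eq_right h.le]
    · have h1 : (((T : ℝ) / Real.log T) ^ (-(1 / β))) ^ β = Real.log T ^ (0 + 1) / T := by
        rw [← Real.rpow_mul (by positivity), neg_mul, one_div_mul_cancel hβ.ne', Real.rpow_neg_one,
          inv_div, zero_add, pow_one]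
      rw [Real.mul_rpow (by positivity) hL.le, Real.mul_rpow hE₀.le (by positivity), h1]
    · calc _ = (1 + 2 * C / B) * E₀ * ((T : ℝ) / Real.log T) ^ (-(1 / β)) * 1 *
            InfiniteArms.tlog (Real.log T / δ) := by ring
        _ ≤ _ := by gcongr; exact InfiniteArms.one_le_tlog_pow _ _
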